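/- Theorem A. Let $p \geq 5$ be a prime, let $G$ be a finite $2$-group that is rational (that is, for every $g \in G$, every generator of $\langle g\rangle$ is conjugate to $g$ in $G$), and let $V$ be a nonzero finite-dimensional vector space over $\mathbb{F}_p$ on which $G$ acts linearly and faithfully with the eigenvector property (that is, for every $v \in V$ and every $\lambda \in \mathbb{F}_p\setminus\{0\}$ there is a $g \in G$ sending $v$ to $\lambda v$). Then $p = 5$, and there are a natural number $n$ and a $2$-subgroup $K$ of the symmetric group $\Sigma_n$ such that $G \cong Q_8 \wr K$, $\dim V = 2n$ and $V \rtimes G \cong \mathfrak{M} \wr K$. Here $Q_8$ is the quaternion group of order $8$; $\mathfrak{M} = C_5^2 \rtimes Q_8$ is the Frobenius group in which $Q_8$ acts on $C_5^2 = \mathbb{F}_5^2$ as a subgroup of $\mathrm{SL}(2,5)$; $V \rtimes G$ is the semidirect product associated with the action of $G$ on $V$; and, for a group $D$ and $K \leq \Sigma_n$, $D \wr K = D^n \rtimes K$ is the wreath product in which $K$ permutes the $n$ coordinates. -/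

import Mathlib

/-- A group is rational if, for every element `g`, every generator `h` of the cyclic subgroup
generated by `g` is conjugate to `g`. -/
def IsRationalGroup (G : Type*) [Group G] : Prop :=
  ∀ g h : G, Subgroup.zpowers h = Subgroup.zpowers g → IsConj g h

/-- The eigenvector property of a representation: for every vector `v` and every nonzero scalar `c`
some group element sends `v` to `c • v`. -/
def HasEigenvectorProperty {F G V : Type*} [Field F] [Group G] [AddCommGroup V] [Module F V]
    (ρ : Representation F G V) : Prop :=
  ∀ (v : V) (c : F), c ≠ 0 → ∃ g : G, ρ g v = c • v

/-- The action by automorphisms of `G` on the additive group of `V` (written multiplicatively)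
given by a representation of `G` on `V`. -/
def repMulAut {R G V : Type*} [CommRing R] [Group G] [AddCommGroup V] [Module R V]
    (ρ : Representation R G V) : G →* MulAut (Multiplicative V) where
  toFun g :=
    { toFun := fun v => Multiplicative.ofAdd (ρ g v.toAdd)
      invFun := fun v => Multiplicative.ofAdd (ρ g⁻¹ v.toAdd)
      left_inv := fun v => by simp
      right_inv := fun v => by simp
      map_mul' := fun v w => by simp }
  map_one' := by ext v; simp
  map_mul' g h := by ext v; simp

/-- The semidirect product `V ⋊ G` associated with a representation of `G` on `V`. -/
abbrev RepSemidirect {R G V : Type*} [CommRing R] [Group G] [AddCommGroup V] [Module R V]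
    (ρ : Representation R G V) : Type _ :=
  Multiplicative V ⋊[repMulAut ρ] G

/-- The (permutational) wreath product `D ≀ K = Dⁿ ⋊ K` of a group `D` with a subgroup `K` of the
symmetric group on `n` letters; `K` permutes the `n` coordinates of `Dⁿ`. -/
abbrev PermWreath (D : Type*) [Group D] {n : ℕ} (K : Subgroup (Equiv.Perm (Fin n))) : Type _ :=
  (Fin n → D) ⋊[(mulAutArrow : K →* MulAut (Fin n → D))] K

/-- The quaternion group of order 8. -/
abbrev Q8 : Type := QuaternionGroup 2

/-- The matrices over the field with five elements representing the elements of `Q8`: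
the generators `a` and `x` go to `diag(2, 3)` and `!![0, 1; -1, 0]`. -/
def q8Matrix : Q8 → Matrix (Fin 2) (Fin 2) (ZMod 5)
  | QuaternionGroup.a i => !![2, 0; 0, 3] ^ (ZMod.val i)
  | QuaternionGroup.xa i => !![0, 1; -1, 0] * !![2, 0; 0, 3] ^ (ZMod.val i)

/-- The embedding of `Q8` into `SL(2, 5)`. -/
def q8ToSL : Q8 →* Matrix.SpecialLinearGroup (Fin 2) (ZMod 5) where
  toFun q := ⟨q8Matrix q, by revert q; decide⟩
  map_one' := Subtype.ext (by decide)
  map_mul' q r := Subtype.ext <| by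
    change q8Matrix (q * r) = q8Matrix q * q8Matrix r
    revert q r
    decide

/-- The natural two-dimensional representation of `Q8` over the field with five elements,
given by the embedding of `Q8` into `SL(2, 5)`. -/
def q8Rep : Representation (ZMod 5) Q8 (Fin 2 → ZMod 5) where
  toFun q := Matrix.toLin' (q8ToSL q).1
  map_one' := by simp [Module.End.one_eq_id]
  map_mul' q r := by simp [Matrix.toLin'_mul, Module.End.mul_eq_comp]

/-- The Frobenius group `C₅² ⋊ Q₈`, with `Q₈` acting on `C₅²` as a subgroup of `SL(2, 5)`. -/
abbrev FrobeniusM : Type := RepSemidirect q8Rep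

/-!
The idea. A finite `2`-group acts on `V` semisimply, so consider an irreducible constituent. Since
`G` is rational, `g` and its odd powers have equal traces (`HasOddPowerTrace`). If some `e` acts as
an involution which is not `±1` and all of whose conjugates act as `±e`, then `V` is the direct sum
of the two eigenspaces of `e`, exchanged by `G`, and each of them is an irreducible representation
of the centraliser of `e` (a subgroup of index two) which again has the eigenvector property and
odd-power traces. So by induction `V` is induced from a representation that does not split in this
way (`irreducible_classification`).

When no such `e` exists, the image of the group has no normal four-group, and it has a cyclic
subgroup of index two which is the centraliser of an element `b` with `b² = -1`
(`exists_cyclic_centralizer`; this needs that `-1` is not the square of a central element, which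
would have nonzero trace). Applying the eigenvector property for `√-1` to the sums of one vector
from each eigenspace of `b`, one sees that the cyclic subgroup acts regularly on the nonzero vectors
of an eigenspace. Counting shows that the eigenspaces are lines, and the trace condition excludes
elements of order eight, so that `p = 5` and the group is `Q8` in its natural representation
(`unsplit_faithful`).

Hence `p = 5`, and `V` is a direct sum of copies of `F₅²` permuted by `G`, on which `G` acts through
`Q8`: `G` is a subgroup of `Q8 ≀ Sym(n)`. It remains to see that `G` contains the base group `Q8ⁿ`
(`Q8Frame.base_eq_top`). Colour a nonzero vector of `F₅²` by the subgroup of order four of `Q8` one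
of whose eigenlines contains it; these three colours are the nonzero elements of `F₂² = Q8 / ±1`,
and the colour is invariant under `Q8`. If `v` has coordinates coloured by `t : Fin n → F₂²` and
`g v = 2 v`, then `g` preserves `t`. If only the identity permutation in the image of `G` does so,
then `g` lies in the base group, and its coordinates are elements of `Q8` of colours `t i`. Such
colourings `t` exist and generate `(F₂²)ⁿ` (`exists_colouring_and_closure_eq_top`). The key to this
last fact is that on a transitive set the sum of the colours can serve as an invariant: two nonzero
distinct elements of `F₂²` have a nonzero sum, so colourings of the two halves of an orbit with
trivial stabiliser and different nonzero sums can be glued to one of the orbit with nonzero sum.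
-/

/-! ### Finite `2`-groups -/

/-- Some iterated square of a nontrivial element of a `2`-group is an involution. -/
theorem IsPGroup.exists_pow_two_pow_involution {G : Type*} [Group G] (hG : IsPGroup 2 G) {g : G}
    (hg : g ≠ 1) : ∃ n : ℕ, g ^ 2 ^ n ≠ 1 ∧ (g ^ 2 ^ n) ^ 2 = 1 := by
  classical
  have hex := hG g
  have hpos : Nat.find hex ≠ 0 := fun h0 => hg (by simpa [h0] using Nat.find_spec hex)
  obtain ⟨n, hn⟩ := Nat.exists_eq_succ_of_ne_zero hpos
  refine ⟨n, Nat.find_min hex (by omega), ?_⟩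
  rw [← pow_mul, ← pow_succ, ← Nat.succ_eq_add_one, ← hn]
  exact Nat.find_spec hex

/-- A proper subgroup of a finite `2`-group is contained in a subgroup of index `2`. -/
theorem IsPGroup.exists_le_index_eq_two {G : Type*} [Group G] [Finite G] (hG : IsPGroup 2 G)
    {M : Subgroup G} (hM : M ≠ ⊤) : ∃ H : Subgroup G, H.index = 2 ∧ M ≤ H := by
  obtain ⟨n, hn⟩ := IsPGroup.iff_card.1 hG
  obtain ⟨k, hk⟩ := IsPGroup.iff_card.1 (hG.to_subgroup M)
  have hkn : k < n := by
    refine lt_of_le_of_ne ?_ fun h => hM (Subgroup.eq_top_of_card_eq M (by rw [hk, hn, h]))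
    exact (Nat.pow_dvd_pow_iff_le_right (by norm_num)).1 (hk ▸ hn ▸ M.card_subgroup_dvd_card)
  obtain ⟨H, hH, hle⟩ := Sylow.exists_subgroup_card_pow_prime_le (G := G) 2 (n := k) (m := n - 1)
    (hn ▸ pow_dvd_pow 2 (Nat.sub_le n 1)) M hk (by omega)
  refine ⟨H, ?_, hle⟩
  have h1 := H.card_mul_index
  rw [hH, hn] at h1
  have h2 : 2 ^ n = 2 ^ (n - 1) * 2 := by rw [← pow_succ]; congr 1; omega
  rw [h2] at h1
  exact Nat.eq_of_mul_eq_mul_left (by positivity) h1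

/-- If `N < M` are normal subgroups of a finite `2`-group, then `M / N` contains a central element
of order `2` of the quotient by `N`. -/
theorem IsPGroup.exists_central_involution_mod {G : Type*} [Group G] [Finite G]
    (hG : IsPGroup 2 G) {N M : Subgroup G} [N.Normal] [M.Normal] (hNM : ¬ M ≤ N) :
    ∃ y ∈ M, y ∉ N ∧ y ^ 2 ∈ N ∧ ∀ g : G, g * y * g⁻¹ * y⁻¹ ∈ N := by
  let π := QuotientGroup.mk' N
  have hπ : Function.Surjective π := QuotientGroup.mk'_surjective N
  have hG' : IsPGroup 2 (G ⧸ N) := hG.to_quotient N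
  let M' := M.map π
  have : M'.Normal := Subgroup.Normal.map inferInstance π hπ
  let _ : MulAction (G ⧸ N) M' := MulAction.compHom M' (MulAut.conjNormal (H := M'))
  have hsm : ∀ (g : G ⧸ N) (x : M'), ((g • x : M') : G ⧸ N) = g * x * g⁻¹ := fun g x => rfl
  obtain ⟨m, hmM, hmN⟩ := SetLike.not_le_iff_exists.1 hNM
  have hdvd : 2 ∣ Nat.card M' := by
    refine (Nat.Prime.eq_one_or_self_of_dvd Nat.prime_two _ (Nat.gcd_dvd_left _ _)).resolve_left ?_
      ▸ Nat.gcd_dvd_right 2 (Nat.card M')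
    intro h1
    obtain ⟨k, hk⟩ := IsPGroup.iff_card.1 (hG'.to_subgroup M')
    have hM1 : Nat.card M' ≠ 1 := by
      intro h
      rw [Subgroup.card_eq_one] at h
      have : π m ∈ M' := Subgroup.mem_map_of_mem π hmM
      rw [h, Subgroup.mem_bot] at this
      exact hmN ((QuotientGroup.eq_one_iff m).1 this)
    rcases Nat.eq_zero_or_pos k with rfl | hk0
    · exact hM1 (by simpa using hk)
    · rw [hk] at h1
      have : 2 ∣ Nat.gcd 2 (2 ^ k) := Nat.dvd_gcd dvd_rfl (dvd_pow_self 2 hk0.ne')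
      omega
  have h1fix : (1 : M') ∈ MulAction.fixedPoints (G ⧸ N) M' := fun g =>
    Subtype.ext (by rw [hsm]; simp)
  obtain ⟨x, hxfix, hx1⟩ :=
    hG'.exists_fixed_point_of_prime_dvd_card_of_fixed_point M' hdvd h1fix
  obtain ⟨n, hn1, hn2⟩ := (hG'.to_subgroup M').exists_pow_two_pow_involution hx1.symm
  obtain ⟨y, hyM, hy⟩ := (x ^ 2 ^ n).2
  have hcomm : ∀ g : G ⧸ N, g * π y * g⁻¹ = π y := by
    intro g
    have hx : g * x * g⁻¹ = (x : G ⧸ N) := by rw [← hsm, hxfix g]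
    rw [hy, Subgroup.coe_pow, ← conj_pow, hx]
  refine ⟨y, hyM, fun h => hn1 ?_, ?_, fun g => ?_⟩
  · exact Subtype.ext (hy.symm.trans ((QuotientGroup.eq_one_iff y).2 h))
  · rw [← QuotientGroup.eq_one_iff]
    change π (y ^ 2) = 1
    rw [map_pow, hy, ← Subgroup.coe_pow, hn2, Subgroup.coe_one]
  · rw [← QuotientGroup.eq_one_iff]
    change π (g * y * g⁻¹ * y⁻¹) = 1
    rw [map_mul, map_mul, map_mul, map_inv, map_inv, hcomm, mul_inv_cancel]

/-! ### Colourings with trivial stabiliser -/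

section Colouring

open scoped Classical in
/-- The colourings `t : S → F₂²` which are good on the orbit `X` of `x`: on `X` the colours are
nonzero, every group element preserving the restriction of `t` to `X` acts trivially on `X`, and
the sum of the colours over `X` is nonzero. -/
def IsGoodColouring (G : Type*) {S : Type*} [Group G] [MulAction G S] [Fintype S] (x : S)
    (t : S → ZMod 2 × ZMod 2) : Prop :=
  (∀ i ∈ MulAction.orbit G x, t i ≠ 0) ∧
  (∀ g : G, (∀ i ∈ MulAction.orbit G x, t (g • i) = t i) →
    ∀ i ∈ MulAction.orbit G x, g • i = i) ∧
  ∑ i, (MulAction.orbit G x).indicator t i ≠ 0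

/-- A group element outside an index-two subgroup `H` containing the stabiliser of `x` moves `x`
out of its `H`-orbit. -/
theorem disjoint_orbit_of_index_two {G S : Type*} [Group G] [MulAction G S] {H : Subgroup G} {x : S}
    (hx : MulAction.stabilizer G x ≤ H) {s : G} (hs : s ∉ H) :
    Disjoint (MulAction.orbit H x) (MulAction.orbit H (s • x)) := by
  rw [Set.disjoint_left]
  rintro _ ⟨⟨h, hh⟩, rfl⟩ ⟨⟨k, hk⟩, hkx⟩
  have h1 : k • s • x = h • x := hkx
  have h2 : h⁻¹ * k * s ∈ H := hx (by
    rw [MulAction.mem_stabilizer_iff, mul_smul, mul_smul, h1, inv_smul_smul])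
  exact hs ((H.mul_mem_cancel_left (H.mul_mem (H.inv_mem hh) hk)).1 h2)

theorem mul_mem_of_index_two {G : Type*} [Group G] {H : Subgroup G} (hH : H.index = 2) {s g : G}
    (hs : s ∉ H) (hg : g ∉ H) : g * s ∈ H :=
  (Subgroup.mul_mem_iff_of_index_two hH).2 (by simp [hs, hg])

theorem orbit_eq_union_of_index_two {G S : Type*} [Group G] [MulAction G S] {H : Subgroup G}
    (hH : H.index = 2) {s : G} (hs : s ∉ H) (x : S) :
    MulAction.orbit G x = MulAction.orbit H x ∪ MulAction.orbit H (s • x) := by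
  ext i
  constructor
  · rintro ⟨g, rfl⟩
    by_cases hg : g ∈ H
    · exact Or.inl ⟨⟨g, hg⟩, rfl⟩
    · refine Or.inr ⟨⟨g * s⁻¹, mul_mem_of_index_two hH (by simpa using hs) hg⟩, ?_⟩
      change (g * s⁻¹) • s • x = g • x
      rw [smul_smul, inv_mul_cancel_right]
  · rintro (⟨⟨h, hh⟩, rfl⟩ | ⟨⟨h, hh⟩, rfl⟩)
    · exact ⟨h, rfl⟩
    · exact ⟨h * s, mul_smul h s x⟩

theorem smul_mem_orbit_swap {G S : Type*} [Group G] [MulAction G S] {H : Subgroup G}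
    (hH : H.index = 2) {s g : G} (hs : s ∉ H) (hg : g ∉ H) (x i : S) :
    g • i ∈ MulAction.orbit H (s • x) ↔ i ∈ MulAction.orbit H x := by
  have := Subgroup.normal_of_index_eq_two hH
  constructor
  · rintro ⟨⟨h, hh⟩, hi⟩
    have hi' : h • s • x = g • i := hi
    have hgs : g⁻¹ * h * s ∈ H :=
      mul_mem_of_index_two hH hs fun hc => hg (by
        simpa using (H.mul_mem_cancel_right hh).1 hc)
    refine ⟨⟨_, hgs⟩, ?_⟩
    change (g⁻¹ * h * s) • x = i
    rw [mul_smul, mul_smul, hi', inv_smul_smul]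
  · rintro ⟨⟨h, hh⟩, rfl⟩
    have hgs : g * h * s⁻¹ ∈ H := mul_mem_of_index_two hH (by simpa using hs) fun hc =>
      hg ((H.mul_mem_cancel_right hh).1 hc)
    refine ⟨⟨_, hgs⟩, ?_⟩
    change (g * h * s⁻¹) • s • x = g • h • x
    rw [smul_smul, inv_mul_cancel_right, mul_smul]

open scoped Classical in
/-- Gluing: good colourings of the two halves of an orbit with different colour sums form a good
colouring of the orbit, because elements exchanging the halves change the colour sum. -/
theorem IsGoodColouring.glue {G S : Type*} [Fintype S] [Group G] [MulAction G S] {H : Subgroup G}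
    (hH : H.index = 2) {x : S} (hx : MulAction.stabilizer G x ≤ H) {s : G} (hs : s ∉ H)
    {t₁ t₂ : S → ZMod 2 × ZMod 2} (h₁ : IsGoodColouring H x t₁) (h₂ : IsGoodColouring H (s • x) t₂)
    (hne : ∑ i, (MulAction.orbit H x).indicator t₁ i ≠
      ∑ i, (MulAction.orbit H (s • x)).indicator t₂ i) :
    IsGoodColouring G x ((MulAction.orbit H x).piecewise t₁ t₂) ∧
    ∑ i, (MulAction.orbit G x).indicator ((MulAction.orbit H x).piecewise t₁ t₂) i =
      ∑ i, (MulAction.orbit H x).indicator t₁ i +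
        ∑ i, (MulAction.orbit H (s • x)).indicator t₂ i := by
  have hdis := disjoint_orbit_of_index_two hx hs
  have hun := orbit_eq_union_of_index_two hH hs x
  set X := MulAction.orbit H x
  set Y := MulAction.orbit H (s • x)
  set T := X.piecewise t₁ t₂
  have hTX : ∀ i ∈ X, T i = t₁ i := fun i hi => Set.piecewise_eq_of_mem X t₁ t₂ hi
  have hTY : ∀ i ∈ Y, T i = t₂ i := fun i hi =>
    Set.piecewise_eq_of_notMem X t₁ t₂ (Set.disjoint_right.1 hdis hi)
  have hiX : X.indicator T = X.indicator t₁ := Set.indicator_congr hTX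
  have hiY : Y.indicator T = Y.indicator t₂ := Set.indicator_congr hTY
  have hsum : ∑ i, (MulAction.orbit G x).indicator T i =
      ∑ i, X.indicator t₁ i + ∑ i, Y.indicator t₂ i := by
    rw [hun, Set.indicator_union_of_disjoint hdis, ← Finset.sum_add_distrib, hiX, hiY]
  have hclosX : ∀ g ∈ H, ∀ i ∈ X, g • i ∈ X := fun g hg i hi =>
    (MulAction.mem_orbit_of_mem_orbit (⟨g, hg⟩ : H) hi :)
  have hclosY : ∀ g ∈ H, ∀ i ∈ Y, g • i ∈ Y := fun g hg i hi =>
    (MulAction.mem_orbit_of_mem_orbit (⟨g, hg⟩ : H) hi :)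
  refine ⟨⟨?_, ?_, ?_⟩, hsum⟩
  · rw [hun]
    rintro i (hi | hi)
    · rw [hTX i hi]; exact h₁.1 i hi
    · rw [hTY i hi]; exact h₂.1 i hi
  · intro g hgT
    rw [hun] at hgT ⊢
    by_cases hg : g ∈ H
    · rintro i (hi | hi)
      · refine h₁.2.1 ⟨g, hg⟩ (fun j hj => ?_) i hi
        have := hgT j (Or.inl hj)
        rwa [hTX j hj, hTX _ (hclosX g hg j hj)] at this
      · refine h₂.2.1 ⟨g, hg⟩ (fun j hj => ?_) i hi
        have := hgT j (Or.inr hj)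
        rwa [hTY j hj, hTY _ (hclosY g hg j hj)] at this
    · refine absurd ?_ hne
      rw [← hiX, ← hiY, ← Equiv.sum_comp (MulAction.toPerm g) (Y.indicator T)]
      refine Finset.sum_congr rfl fun i _ => ?_
      have hiff := smul_mem_orbit_swap hH hs hg x i
      rw [MulAction.toPerm_apply]
      by_cases hi : i ∈ X
      · rw [Set.indicator_of_mem hi, Set.indicator_of_mem (hiff.2 hi), hgT i (Or.inl hi)]
      · rw [Set.indicator_of_notMem hi, Set.indicator_of_notMem fun h => hi (hiff.1 h)]
  · rw [hsum]
    exact fun h => hne (by rw [add_eq_zero_iff_eq_neg.1 h, CharTwo.neg_eq])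

open scoped Classical in
/-- On every orbit of a finite `2`-group, each nonzero value is the colour sum of a good colouring,
and the differences of good colourings span all colourings of the orbit. The induction replaces the
group by a subgroup of index two containing a point stabiliser, which halves the orbit. -/
theorem exists_isGoodColouring_and_span {S : Type*} [Fintype S] (n : ℕ) :
    ∀ (G : Type*) [Group G] [Finite G] [MulAction G S] (_ : IsPGroup 2 G) (x : S)
      (_ : (MulAction.orbit G x).ncard = n),
    (∀ q : ZMod 2 × ZMod 2, q ≠ 0 → ∃ t : S → ZMod 2 × ZMod 2, IsGoodColouring G x t ∧
      ∑ i, (MulAction.orbit G x).indicator t i = q) ∧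
    ∀ D : AddSubgroup (S → ZMod 2 × ZMod 2),
      (∀ t t', IsGoodColouring G x t → IsGoodColouring G x t' →
        (MulAction.orbit G x).indicator (t - t') ∈ D) →
      ∀ f, (MulAction.orbit G x).indicator f ∈ D := by
  induction n using Nat.strong_induction_on with
  | _ n ih =>
  intro G _ _ _ hG x hn
  by_cases hst : MulAction.stabilizer G x = ⊤
  · have horb : MulAction.orbit G x = {x} := by
      ext i
      constructor
      · rintro ⟨g, rfl⟩
        exact (hst ▸ Subgroup.mem_top g : g ∈ MulAction.stabilizer G x)
      · rintro rfl
        exact MulAction.mem_orbit_self _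
    have hsum : ∀ t : S → ZMod 2 × ZMod 2, ∑ i, ({x} : Set S).indicator t i = t x := by
      intro t
      simp [Set.indicator_apply]
    have hgood : ∀ t : S → ZMod 2 × ZMod 2, t x ≠ 0 → IsGoodColouring G x t := by
      intro t ht
      refine ⟨?_, ?_, ?_⟩
      · simpa [horb] using ht
      · intro g _ i hi
        rw [horb, Set.mem_singleton_iff] at hi
        subst hi
        exact (hst ▸ Subgroup.mem_top g : g ∈ MulAction.stabilizer G i)
      · rwa [horb, hsum]
    refine ⟨fun q hq => ⟨fun _ => q, hgood _ hq, by rw [horb, hsum]⟩, fun D hD f => ?_⟩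
    obtain ⟨q, hq0, hqf⟩ : ∃ q : ZMod 2 × ZMod 2, q ≠ 0 ∧ f x + q ≠ 0 := by
      generalize f x = a
      revert a
      decide
    have := hD (fun _ => f x + q) (fun _ => q) (hgood _ hqf) (hgood _ hq0)
    convert this using 1
    rw [horb]
    refine Set.indicator_congr fun i hi => ?_
    rw [Set.mem_singleton_iff] at hi
    subst hi
    simp
  obtain ⟨H, hH, hle⟩ := hG.exists_le_index_eq_two hst
  obtain ⟨s, hs⟩ : ∃ s, s ∉ H := by
    by_contra! hall
    rw [(Subgroup.eq_top_iff' H).2 hall, Subgroup.index_top] at hH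
    omega
  have hun := orbit_eq_union_of_index_two hH hs x
  have hdis := disjoint_orbit_of_index_two hle hs
  have hcard : ∀ y : S, (MulAction.orbit H y).ncard ≠ 0 := fun y =>
    Set.ncard_ne_zero_of_mem (MulAction.mem_orbit_self y) (Set.toFinite _)
  have hn' : (MulAction.orbit H x).ncard + (MulAction.orbit H (s • x)).ncard = n := by
    rw [← hn, hun, Set.ncard_union_eq hdis]
  have hx0 := hcard x
  have hy0 := hcard (s • x)
  obtain ⟨a₁, b₁⟩ := ih _ (by omega) H (hG.to_subgroup H) x rfl
  obtain ⟨a₂, b₂⟩ := ih _ (by omega) H (hG.to_subgroup H) (s • x) rfl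
  refine ⟨fun q hq => ?_, fun D hD f => ?_⟩
  · obtain ⟨u, v, hu, hv, huv, rfl⟩ : ∃ u v : ZMod 2 × ZMod 2,
        u ≠ 0 ∧ v ≠ 0 ∧ u ≠ v ∧ u + v = q := by
      revert q
      decide
    obtain ⟨t₁, h₁, rfl⟩ := a₁ u hu
    obtain ⟨t₂, h₂, rfl⟩ := a₂ v hv
    exact ⟨_, h₁.glue hH hle hs h₂ huv⟩
  · have havoid : ∀ u v : ZMod 2 × ZMod 2, ∃ q, q ≠ 0 ∧ u ≠ q ∧ v ≠ q := by decide
    have hX : (MulAction.orbit H x).indicator f ∈ D := by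
      refine b₁ D (fun t t' ht ht' => ?_) f
      obtain ⟨q, hq0, hq, hq'⟩ := havoid (∑ i, (MulAction.orbit H x).indicator t i)
        (∑ i, (MulAction.orbit H x).indicator t' i)
      obtain ⟨t₂, h₂, rfl⟩ := a₂ q hq0
      convert hD _ _ (ht.glue hH hle hs h₂ hq).1 (ht'.glue hH hle hs h₂ hq').1 using 1
      rw [hun]
      ext1 i
      by_cases hi : i ∈ MulAction.orbit H x <;> simp [Set.indicator_apply, hi]
    have hY : (MulAction.orbit H (s • x)).indicator f ∈ D := by
      refine b₂ D (fun t t' ht ht' => ?_) f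
      obtain ⟨q, hq0, hq, hq'⟩ := havoid (∑ i, (MulAction.orbit H (s • x)).indicator t i)
        (∑ i, (MulAction.orbit H (s • x)).indicator t' i)
      obtain ⟨t₁, h₁, rfl⟩ := a₁ q hq0
      convert hD _ _ (h₁.glue hH hle hs ht hq.symm).1 (h₁.glue hH hle hs ht' hq'.symm).1 using 1
      rw [hun]
      ext1 i
      by_cases hi : i ∈ MulAction.orbit H x
      · simp [hi, Set.disjoint_left.1 hdis hi]
      · by_cases hi' : i ∈ MulAction.orbit H (s • x) <;> simp [hi, hi']
    rw [hun, Set.indicator_union_of_disjoint hdis]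
    exact D.add_mem hX hY

/-- For a finite `2`-group acting on a finite set there is a nowhere zero colouring by `F₂²` whose
stabiliser acts trivially, and such colourings generate the group of all colourings. -/
theorem exists_colouring_and_closure_eq_top {G S : Type*} [Finite S] [Group G] [Finite G]
    [MulAction G S] (hG : IsPGroup 2 G) :
    (∃ t : S → ZMod 2 × ZMod 2, (∀ i, t i ≠ 0) ∧
      ∀ g : G, (∀ i, t (g • i) = t i) → ∀ i : S, g • i = i) ∧
    ∀ D : AddSubgroup (S → ZMod 2 × ZMod 2),
      (∀ t : S → ZMod 2 × ZMod 2, (∀ i, t i ≠ 0) →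
        (∀ g : G, (∀ i, t (g • i) = t i) → ∀ i : S, g • i = i) → t ∈ D) → D = ⊤ := by
  classical
  have := Fintype.ofFinite S
  have key := fun x : S => exists_isGoodColouring_and_span _ G hG x rfl
  have hex : ∀ o : MulAction.orbitRel.Quotient G S, ∃ t, IsGoodColouring G o.out t := fun o =>
    let ⟨t, ht, _⟩ := (key o.out).1 (1, 1) (by decide)
    ⟨t, ht⟩
  choose c hc using hex
  -- `t₀` is good on every orbit
  let t₀ : S → ZMod 2 × ZMod 2 := fun i => c (Quotient.mk'' i) i
  have hout : ∀ i : S, i ∈ MulAction.orbit G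
      (Quotient.mk'' i : MulAction.orbitRel.Quotient G S).out := fun i =>
    MulAction.orbitRel_apply.1 (Quotient.exact' (Quotient.out_eq' _).symm)
  have hmem : ∀ (i j : S), j ∈ MulAction.orbit G
      (Quotient.mk'' i : MulAction.orbitRel.Quotient G S).out →
      (Quotient.mk'' j : MulAction.orbitRel.Quotient G S) = Quotient.mk'' i := by
    intro i j hj
    rw [← Quotient.out_eq' (Quotient.mk'' i : MulAction.orbitRel.Quotient G S)]
    exact Quotient.sound' hj
  have hgood₀ : ∀ o : MulAction.orbitRel.Quotient G S, ∀ j ∈ MulAction.orbit G o.out,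
      t₀ j = c o j := by
    intro o j hj
    induction o using Quotient.inductionOn' with
    | h i => simp only [t₀]; rw [hmem i j hj]
  have h₀ne : ∀ i, t₀ i ≠ 0 := fun i => (hc _).1 i (hout i)
  have h₀st : ∀ g : G, ∀ i, (∀ j ∈ MulAction.orbit G
      (Quotient.mk'' i : MulAction.orbitRel.Quotient G S).out, t₀ (g • j) = t₀ j) →
      g • i = i := by
    intro g i h
    refine (hc (Quotient.mk'' i)).2.1 g (fun j hj => ?_) i (hout i)
    rw [← hgood₀ _ j hj, ← h j hj, hgood₀ _ _ (MulAction.mem_orbit_of_mem_orbit g hj)]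
  refine ⟨⟨t₀, h₀ne, fun g hg i => h₀st g i fun j _ => hg j⟩, fun D hD => ?_⟩
  have hsingle : ∀ x : S, ∀ f, (MulAction.orbit G x).indicator f ∈ D := by
    intro x
    refine (key x).2 D fun t t' ht ht' => ?_
    have hpw : ∀ t, IsGoodColouring G x t → (MulAction.orbit G x).piecewise t t₀ ∈ D := by
      intro t ht
      refine hD _ (fun i => ?_) fun g hg i => ?_
      · by_cases hi : i ∈ MulAction.orbit G x
        · simpa [hi] using ht.1 i hi
        · simpa [hi] using h₀ne i
      · have hgo : ∀ j, g • j ∈ MulAction.orbit G x ↔ j ∈ MulAction.orbit G x := fun j =>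
          ⟨fun h => by simpa using MulAction.mem_orbit_of_mem_orbit g⁻¹ h,
            MulAction.mem_orbit_of_mem_orbit g⟩
        by_cases hi : i ∈ MulAction.orbit G x
        · refine ht.2.1 g (fun j hj => ?_) i hi
          have := hg j
          rwa [Set.piecewise_eq_of_mem _ _ _ hj,
            Set.piecewise_eq_of_mem _ _ _ ((hgo j).2 hj)] at this
        · refine h₀st g i fun j hj => ?_
          have hjx : j ∉ MulAction.orbit G x := by
            intro hjx
            have h1 := MulAction.orbit_eq_iff.2 hjx
            have h2 := MulAction.orbit_eq_iff.2 hj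
            have h3 := MulAction.orbit_eq_iff.2 (hout i)
            exact hi (by rw [← h1, h2, ← h3]; exact MulAction.mem_orbit_self i)
          have := hg j
          rwa [Set.piecewise_eq_of_notMem _ _ _ hjx,
            Set.piecewise_eq_of_notMem _ _ _ (fun h => hjx ((hgo j).1 h))] at this
    convert D.sub_mem (hpw t ht) (hpw t' ht') using 1
    ext1 i
    by_cases hi : i ∈ MulAction.orbit G x <;> simp [hi]
  rw [AddSubgroup.eq_top_iff']
  intro f
  rw [← Finset.univ_sum_single f]
  refine D.sum_mem fun i _ => ?_
  convert hsingle i (Pi.single i (f i)) using 1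
  ext1 j
  by_cases hj : j = i
  · subst hj
    rw [Set.indicator_of_mem (MulAction.mem_orbit_self j)]
  · simp [Set.indicator_apply, Pi.single_eq_of_ne hj]

end Colouring

/-! ### Clifford theory for subgroups of index two -/

section Clifford

open Module

variable {F G V : Type*} [Field F] [Group G] [AddCommGroup V] [Module F V]
  {ρ : Representation F G V}

/-- The restriction of a representation to a subgroup. -/
def Representation.restrictSubgroup (ρ : Representation F G V) (N : Subgroup G) :
    Representation F N V := MonoidHom.comp ρ N.subtype

theorem Representation.apply_mul_apply (ρ : Representation F G V) (g h : G) (v : V) :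
    ρ g (ρ h v) = ρ (g * h) v := by rw [map_mul]; rfl

theorem Representation.IsIrreducible.submodule_eq (hρ : ρ.IsIrreducible) {U : Submodule F V}
    (hU : ∀ g, ∀ v ∈ U, ρ g v ∈ U) : U = ⊥ ∨ U = ⊤ :=
  (hρ.eq_bot_or_eq_top ⟨U, fun g v hv => hU g v hv⟩).imp
    (congrArg Subrepresentation.toSubmodule) (congrArg Subrepresentation.toSubmodule)

theorem Representation.isIrreducible_of_submodule [Nontrivial V]
    (h : ∀ U : Submodule F V, (∀ g, ∀ v ∈ U, ρ g v ∈ U) → U = ⊥ ∨ U = ⊤) : ρ.IsIrreducible where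
  exists_pair_ne := ⟨⊥, ⊤, fun hbt => bot_ne_top (α := Submodule F V)
    (congrArg Subrepresentation.toSubmodule hbt)⟩
  eq_bot_or_eq_top W := (h W.toSubmodule fun g _ hv => W.apply_mem_toSubmodule g hv).imp
    (fun hW => Subrepresentation.toSubmodule_injective hW)
    (fun hW => Subrepresentation.toSubmodule_injective hW)

theorem Representation.IsIrreducible.nontrivial (hρ : ρ.IsIrreducible) : Nontrivial V := by
  obtain ⟨A, B, hAB⟩ := hρ.exists_pair_ne
  by_contra hV
  rw [not_nontrivial_iff_subsingleton] at hV
  exact hAB (Subrepresentation.toSubmodule_injective (Subsingleton.elim _ _))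

/-- A version of Schur's lemma: an endomorphism commuting with an irreducible representation and
killed by `(X - α) (X - β)` is the scalar `α` or the scalar `β`. -/
theorem Representation.IsIrreducible.eq_smul_or_eq_smul (hρ : ρ.IsIrreducible) {T : V →ₗ[F] V}
    (hT : ∀ g v, T (ρ g v) = ρ g (T v)) {α β : F}
    (hαβ : ∀ v, T (T v - β • v) = α • (T v - β • v)) :
    (∀ v, T v = α • v) ∨ ∀ v, T v = β • v := by
  rcases hρ.submodule_eq (U := End.eigenspace T α) (fun g v hv => by
    rw [End.mem_eigenspace_iff] at hv ⊢
    rw [hT, hv, map_smul]) with h | h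
  · right
    intro v
    have : T v - β • v ∈ End.eigenspace T α := End.mem_eigenspace_iff.2 (hαβ v)
    rwa [h, Submodule.mem_bot, sub_eq_zero] at this
  · left
    intro v
    exact End.mem_eigenspace_iff.1 (h ▸ Submodule.mem_top : v ∈ End.eigenspace T α)

variable {N : Subgroup G} {s : G}

theorem sq_mem_of_index_two (hN : N.index = 2) (s : G) : s * s ∈ N :=
  (Subgroup.mul_mem_iff_of_index_two hN).2 Iff.rfl

/-- A proper nonzero subrepresentation `W` for a subgroup of index two of an irreducible
representation is complemented by each translate of `W`. -/
theorem Representation.IsIrreducible.isCompl_map (hρ : ρ.IsIrreducible) (hN : N.index = 2)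
    (hs : s ∉ N) {W : Submodule F V} (hW : ∀ g ∈ N, ∀ v ∈ W, ρ g v ∈ W)
    (hbot : W ≠ ⊥) (htop : W ≠ ⊤) : IsCompl W (W.map (ρ s)) := by
  have hNn := Subgroup.normal_of_index_eq_two hN
  have hsW : ∀ g ∈ N, ∀ v ∈ W.map (ρ s), ρ g v ∈ W.map (ρ s) := by
    rintro g hg _ ⟨w, hw, rfl⟩
    refine ⟨ρ (s⁻¹ * g * s) w, hW _ (by simpa using hNn.conj_mem g hg s⁻¹) w hw, ?_⟩
    rw [ρ.apply_mul_apply, ρ.apply_mul_apply]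
    congr 2
    group
  have hswap : ∀ g ∉ N, ∀ v ∈ W, ρ g v ∈ W.map (ρ s) := by
    intro g hg v hv
    refine ⟨ρ (s⁻¹ * g) v, hW _ (mul_mem_of_index_two hN hg (by simpa using hs)) v hv, ?_⟩
    rw [ρ.apply_mul_apply, mul_inv_cancel_left]
  have hswap' : ∀ g ∉ N, ∀ v ∈ W.map (ρ s), ρ g v ∈ W := by
    rintro g hg _ ⟨w, hw, rfl⟩
    rw [ρ.apply_mul_apply]
    exact hW _ (mul_mem_of_index_two hN hs hg) w hw
  have hinf : W ⊓ W.map (ρ s) = ⊥ := by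
    refine (hρ.submodule_eq (U := W ⊓ W.map (ρ s)) fun g v hv => ?_).resolve_right
      fun h => htop (top_le_iff.1 (h ▸ inf_le_left))
    by_cases hg : g ∈ N
    · exact ⟨hW g hg v hv.1, hsW g hg v hv.2⟩
    · exact ⟨hswap' g hg v hv.2, hswap g hg v hv.1⟩
  have hsup : W ⊔ W.map (ρ s) = ⊤ := by
    refine (hρ.submodule_eq (U := W ⊔ W.map (ρ s)) fun g v hv => ?_).resolve_left
      fun h => hbot (le_bot_iff.1 (h ▸ le_sup_left))
    obtain ⟨x, hx, y, hy, rfl⟩ := Submodule.mem_sup.1 hv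
    rw [map_add]
    by_cases hg : g ∈ N
    · exact Submodule.add_mem_sup (hW g hg x hx) (hsW g hg y hy)
    · rw [add_comm]
      exact Submodule.add_mem_sup (hswap' g hg y hy) (hswap g hg x hx)
  exact ⟨disjoint_iff.2 hinf, codisjoint_iff.2 hsup⟩

theorem Representation.IsIrreducible.finrank_eq_two_mul [FiniteDimensional F V]
    (hρ : ρ.IsIrreducible) (hN : N.index = 2)
    (hs : s ∉ N) {W : Submodule F V} (hW : ∀ g ∈ N, ∀ v ∈ W, ρ g v ∈ W)
    (hbot : W ≠ ⊥) (htop : W ≠ ⊤) : finrank F V = 2 * finrank F W := by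
  have h := Submodule.finrank_add_eq_of_isCompl (hρ.isCompl_map hN hs hW hbot htop)
  have hinj : Function.Injective (ρ s) := (ρ.apply_bijective s).1
  rw [← (Submodule.equivMapOfInjective (ρ s) hinj W).finrank_eq] at h
  omega

theorem Representation.IsIrreducible.submodule_eq_of_le [FiniteDimensional F V]
    (hρ : ρ.IsIrreducible) (hN : N.index = 2)
    (hs : s ∉ N) {W : Submodule F V} (hW : ∀ g ∈ N, ∀ v ∈ W, ρ g v ∈ W)
    (htop : W ≠ ⊤) {U : Submodule F V} (hUW : U ≤ W) (hU : ∀ g ∈ N, ∀ v ∈ U, ρ g v ∈ U) :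
    U = ⊥ ∨ U = W := by
  by_cases hbot : U = ⊥
  · exact Or.inl hbot
  · right
    have hWbot : W ≠ ⊥ := fun h => hbot (le_bot_iff.1 (h ▸ hUW))
    have hUtop : U ≠ ⊤ := fun h => htop (top_le_iff.1 (h ▸ hUW))
    have h1 := hρ.finrank_eq_two_mul hN hs hW hWbot htop
    have h2 := hρ.finrank_eq_two_mul hN hs hU hbot hUtop
    exact Submodule.eq_of_le_of_finrank_eq hUW (by omega)

/-- A subspace stable under a subgroup, as a subrepresentation of the restriction. -/
def Representation.stableSubrep (ρ : Representation F G V) (N : Subgroup G) (W : Submodule F V)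
    (hW : ∀ g ∈ N, ∀ v ∈ W, ρ g v ∈ W) : Subrepresentation (ρ.restrictSubgroup N) :=
  ⟨W, fun g v hv => hW g g.2 v hv⟩

theorem Representation.IsIrreducible.stableSubrep [FiniteDimensional F V]
    (hρ : ρ.IsIrreducible) (hN : N.index = 2)
    (hs : s ∉ N) {W : Submodule F V} (hW : ∀ g ∈ N, ∀ v ∈ W, ρ g v ∈ W)
    (hbot : W ≠ ⊥) (htop : W ≠ ⊤) :
    (ρ.stableSubrep N W hW).toRepresentation.IsIrreducible := by
  have : Nontrivial (ρ.stableSubrep N W hW).toSubmodule := Submodule.nontrivial_iff_ne_bot.2 hbot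
  refine Representation.isIrreducible_of_submodule fun U hU => ?_
  have hmap : U.map W.subtype ≤ W := Submodule.map_subtype_le W U
  rcases hρ.submodule_eq_of_le hN hs hW htop hmap (by
    rintro g hg _ ⟨u, hu, rfl⟩
    exact ⟨_, hU ⟨g, hg⟩ u hu, rfl⟩) with h | h
  · exact Or.inl (Submodule.map_injective_of_injective W.injective_subtype
      (h.trans (Submodule.map_bot _).symm))
  · right
    rw [eq_top_iff]
    intro w _
    obtain ⟨u, hu, huw⟩ : (w : V) ∈ U.map W.subtype := by rw [h]; exact w.2
    rwa [← Subtype.ext huw]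

/-- The degree of an irreducible representation of a finite `2`-group is a power of `2`. -/
theorem Representation.IsIrreducible.finrank_eq_two_pow (n : ℕ) :
    ∀ (G V : Type*) [Group G] [Finite G] [AddCommGroup V] [Module F V] [FiniteDimensional F V]
      (ρ : Representation F G V) (_ : ρ.IsIrreducible) (_ : IsPGroup 2 G) (_ : Nat.card G = n),
      ∃ k, finrank F V = 2 ^ k := by
  induction n using Nat.strong_induction_on with
  | _ n ih =>
  intro G V _ _ _ _ _ ρ hρ hG hn
  have := hρ.nontrivial
  by_cases hbt : (⊥ : Subgroup G) = ⊤
  · refine ⟨0, ?_⟩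
    obtain ⟨v, hv⟩ := exists_ne (0 : V)
    have hg : ∀ g : G, g = 1 := fun g => Subgroup.mem_bot.1 (hbt ▸ Subgroup.mem_top g)
    rcases hρ.submodule_eq (U := F ∙ v) (fun g w hw => by rwa [hg g, map_one]) with h | h
    · exact absurd (Submodule.span_singleton_eq_bot.1 h) hv
    · rw [← finrank_top F V, ← h, finrank_span_singleton hv, pow_zero]
  obtain ⟨N, hN, -⟩ := hG.exists_le_index_eq_two hbt
  obtain ⟨s, hs⟩ : ∃ s, s ∉ N := by
    by_contra! hall
    rw [(Subgroup.eq_top_iff' N).2 hall, Subgroup.index_top] at hN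
    omega
  have hcard : Nat.card N < n := by
    have h1 := N.card_mul_index
    have h2 : 0 < Nat.card N := Nat.card_pos
    rw [hN, hn] at h1
    omega
  by_cases hirr : (ρ.restrictSubgroup N).IsIrreducible
  · exact ih _ hcard N V (ρ.restrictSubgroup N) hirr (hG.to_subgroup N) rfl
  · obtain ⟨W, hW, hbot, htop⟩ : ∃ W : Submodule F V, (∀ g ∈ N, ∀ v ∈ W, ρ g v ∈ W) ∧
        W ≠ ⊥ ∧ W ≠ ⊤ := by
      by_contra! hall
      refine hirr (Representation.isIrreducible_of_submodule fun U hU => ?_)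
      by_cases hb : U = ⊥
      · exact Or.inl hb
      · exact Or.inr (hall U (fun g hg => hU ⟨g, hg⟩) hb)
    obtain ⟨k, hk⟩ := ih _ hcard N _ _ (hρ.stableSubrep hN hs hW hbot htop) (hG.to_subgroup N) rfl
    refine ⟨k + 1, ?_⟩
    rw [hρ.finrank_eq_two_mul hN hs hW hbot htop, pow_succ, ← hk, mul_comm]
    rfl

end Clifford

/-! ### Splitting a representation along an eigenspace -/

section Splitting

open Module

variable {F G V U : Type*} [Field F] [Group G] [AddCommGroup V] [Module F V]
  [AddCommGroup U] [Module F U] {ρ : Representation F G V}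

/-- The trace of a group element is unchanged under odd powers. For a `2`-group this is the trace
of the rationality of the group; unlike rationality, it is inherited in the splitting argument. -/
def HasOddPowerTrace (ρ : Representation F G V) : Prop :=
  ∀ (g : G) (k : ℕ), Odd k → LinearMap.trace F V (ρ (g ^ k)) = LinearMap.trace F V (ρ g)

/-- A frame of a representation on `V`: a decomposition of `V` into copies of `U` (the images of
the maps `ε i`) which are permuted by the group, such that in the coordinates on the copies the
group acts through endomorphisms of `U` belonging to the set `Q`. -/
def HasFrame (Q : Set (U →ₗ[F] U)) (ρ : Representation F G V) : Prop :=
  ∃ (S : Type) (_ : Fintype S) (ε : S → U →ₗ[F] V),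
    Function.Bijective (fun u : S → U => ∑ i, ε i (u i)) ∧
      ∀ g i, ∃ j, ∃ T ∈ Q, ∀ u, ρ g (ε i u) = ε j (T u)

theorem Submodule.bijective_add_of_isCompl {X Y : Type*} {p q : Submodule F V} (hpq : IsCompl p q)
    {A : X → p} {B : Y → q} (hA : Function.Bijective A) (hB : Function.Bijective B) :
    Function.Bijective fun z : X × Y => (A z.1 : V) + B z.2 :=
  (Submodule.prodEquivOfIsCompl p q hpq).bijective.comp (hA.prodMap hB)

theorem bijective_sum_elim {S₁ S₂ : Type*} [Fintype S₁] [Fintype S₂] {p q : Submodule F V}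
    (hpq : IsCompl p q) {ε₁ : S₁ → U →ₗ[F] p} {ε₂ : S₂ → U →ₗ[F] q}
    (h₁ : Function.Bijective fun u : S₁ → U => ∑ i, ε₁ i (u i))
    (h₂ : Function.Bijective fun u : S₂ → U => ∑ i, ε₂ i (u i)) :
    Function.Bijective fun u : S₁ ⊕ S₂ → U =>
      ∑ i, (Sum.elim (fun i => p.subtype ∘ₗ ε₁ i) (fun i => q.subtype ∘ₗ ε₂ i) i) (u i) := by
  convert (Submodule.bijective_add_of_isCompl hpq h₁ h₂).comp
    (Equiv.sumArrowEquivProdArrow S₁ S₂ U).bijective using 1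
  funext u
  simp [Equiv.sumArrowEquivProdArrow]

/-- A frame of a subrepresentation for a subgroup of index two whose translate is a complement
yields a frame of the whole representation: add the translated copies. -/
theorem HasFrame.induce {Q : Set (U →ₗ[F] U)} {N : Subgroup G} {s : G} (hN : N.index = 2)
    (hs : s ∉ N) {W : Submodule F V} (hW : ∀ g ∈ N, ∀ v ∈ W, ρ g v ∈ W)
    (hc : IsCompl W (W.map (ρ s)))
    (h : HasFrame Q (ρ.stableSubrep N W hW).toRepresentation) : HasFrame Q ρ := by
  obtain ⟨S, _, ε, hbij, hε⟩ := h
  let ε₁ : S → U →ₗ[F] W := ε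
  let sW : W ≃ₗ[F] W.map (ρ s) :=
    Submodule.equivMapOfInjective (ρ s) (ρ.apply_bijective s).1 W
  have hN' := Subgroup.normal_of_index_eq_two hN
  have h₁ : Function.Bijective fun u : S → U => ∑ i, ε₁ i (u i) := hbij
  have h₂ : Function.Bijective fun u : S → U => ∑ i, (sW.toLinearMap ∘ₗ ε₁ i) (u i) := by
    convert sW.bijective.comp h₁ using 1
    funext u
    simp
  have hact : ∀ g ∈ N, ∀ i, ∃ j, ∃ T ∈ Q, ∀ u, ρ g (ε₁ i u : V) = ε₁ j (T u) := by
    intro g hg i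
    obtain ⟨j, T, hT, hj⟩ := hε ⟨g, hg⟩ i
    exact ⟨j, T, hT, fun u => congrArg Subtype.val (hj u)⟩
  refine ⟨S ⊕ S, inferInstance, _, bijective_sum_elim hc h₁ h₂, ?_⟩
  rintro g (i | i)
  · by_cases hg : g ∈ N
    · obtain ⟨j, T, hT, hj⟩ := hact g hg i
      exact ⟨Sum.inl j, T, hT, fun u => hj u⟩
    · obtain ⟨j, T, hT, hj⟩ := hact (s⁻¹ * g)
        (mul_mem_of_index_two hN hg (by simpa using hs)) i
      refine ⟨Sum.inr j, T, hT, fun u => ?_⟩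
      change ρ g (ε₁ i u : V) = ρ s (ε₁ j (T u) : V)
      rw [← hj, ρ.apply_mul_apply, mul_inv_cancel_left]
  · by_cases hg : g ∈ N
    · obtain ⟨j, T, hT, hj⟩ := hact (s⁻¹ * g * s) (by simpa using hN'.conj_mem g hg s⁻¹) i
      refine ⟨Sum.inr j, T, hT, fun u => ?_⟩
      change ρ g (ρ s (ε₁ i u : V)) = ρ s (ε₁ j (T u) : V)
      rw [← hj, ρ.apply_mul_apply, ρ.apply_mul_apply]
      congr 2
      group
    · obtain ⟨j, T, hT, hj⟩ := hact (g * s) (mul_mem_of_index_two hN hs hg) i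
      refine ⟨Sum.inl j, T, hT, fun u => ?_⟩
      change ρ g (ρ s (ε₁ i u : V)) = (ε₁ j (T u) : V)
      rw [← hj, ρ.apply_mul_apply]

theorem HasFrame.of_isCompl {Q : Set (U →ₗ[F] U)} {W₁ W₂ : Subrepresentation ρ}
    (hc : IsCompl W₁.toSubmodule W₂.toSubmodule) (h₁ : HasFrame Q W₁.toRepresentation)
    (h₂ : HasFrame Q W₂.toRepresentation) : HasFrame Q ρ := by
  obtain ⟨S₁, _, ε₁, hbij₁, hε₁⟩ := h₁
  obtain ⟨S₂, _, ε₂, hbij₂, hε₂⟩ := h₂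
  refine ⟨S₁ ⊕ S₂, inferInstance, _, bijective_sum_elim hc hbij₁ hbij₂, ?_⟩
  rintro g (i | i)
  · obtain ⟨j, T, hT, hj⟩ := hε₁ g i
    exact ⟨Sum.inl j, T, hT, fun u => congrArg Subtype.val (hj u)⟩
  · obtain ⟨j, T, hT, hj⟩ := hε₂ g i
    exact ⟨Sum.inr j, T, hT, fun u => congrArg Subtype.val (hj u)⟩

/-- The subgroup of the elements whose action commutes with the endomorphism `T`. -/
def Representation.commutingSubgroup (ρ : Representation F G V) (T : V →ₗ[F] V) : Subgroup G where
  carrier := {g | ∀ v, ρ g (T v) = T (ρ g v)}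
  one_mem' := by simp
  mul_mem' {g h} hg hh v := by
    rw [← ρ.apply_mul_apply, hh, hg, ρ.apply_mul_apply]
  inv_mem' {g} hg v := by
    apply (ρ.apply_bijective g).1
    rw [hg, ρ.self_inv_apply, ρ.self_inv_apply]

theorem Representation.commutingSubgroup_index {T : V →ₗ[F] V}
    (hT : ∀ g, (∀ v, ρ g (T v) = T (ρ g v)) ∨ ∀ v, ρ g (T v) = -T (ρ g v)) {s : G}
    (hs : s ∉ ρ.commutingSubgroup T) : (ρ.commutingSubgroup T).index = 2 := by
  rw [Subgroup.index_eq_two_iff]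
  refine ⟨s, fun g => ?_⟩
  by_cases hg : g ∈ ρ.commutingSubgroup T
  · exact Or.inr ⟨hg, fun h => hs ((Subgroup.mul_mem_cancel_left _ hg).1 h)⟩
  · refine Or.inl ⟨fun v => ?_, hg⟩
    rw [← ρ.apply_mul_apply, (hT s).resolve_left hs, map_neg, (hT g).resolve_left hg, neg_neg,
      ρ.apply_mul_apply]

theorem Representation.eigenspace_stable {T : V →ₗ[F] V} {α : F} :
    ∀ g ∈ ρ.commutingSubgroup T, ∀ v ∈ End.eigenspace T α, ρ g v ∈ End.eigenspace T α := by
  intro g hg v hv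
  rw [End.mem_eigenspace_iff] at hv ⊢
  rw [← hg, hv, map_smul]

/-- If `T² = α²` and `T` is not central, the eigenspace of `T` for `α` is proper and nonzero. -/
theorem Representation.eigenspace_ne {T : V →ₗ[F] V} {α : F} (hT2 : ∀ v, T (T v) = (α * α) • v)
    {s : G} (hs : s ∉ ρ.commutingSubgroup T) :
    End.eigenspace T α ≠ ⊥ ∧ End.eigenspace T α ≠ ⊤ := by
  constructor
  · refine fun hb => hs fun v => ?_
    have hT : ∀ v, T v = -(α • v) := by
      intro v
      have : T v + α • v ∈ End.eigenspace T α := by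
        rw [End.mem_eigenspace_iff, map_add, hT2, map_smul, smul_add, smul_smul, add_comm]
      rw [hb, Submodule.mem_bot] at this
      exact eq_neg_of_add_eq_zero_left this
    rw [hT, hT, map_neg, map_smul]
  · refine fun ht => hs fun v => ?_
    have hT : ∀ v, T v = α • v := fun v =>
      End.mem_eigenspace_iff.1 (ht ▸ Submodule.mem_top : v ∈ End.eigenspace T α)
    rw [hT, hT, map_smul]

theorem HasEigenvectorProperty.stableSubrep (hρ : HasEigenvectorProperty ρ) {N : Subgroup G}
    {W : Submodule F V} (hW : ∀ g ∈ N, ∀ v ∈ W, ρ g v ∈ W)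
    (hdis : ∀ g ∉ N, ∀ v ∈ W, ρ g v ∈ W → v = 0) :
    HasEigenvectorProperty (ρ.stableSubrep N W hW).toRepresentation := by
  intro v c hc
  by_cases hv : v = 0
  · exact ⟨1, by simp [hv]⟩
  obtain ⟨g, hg⟩ := hρ v c hc
  have hgN : g ∈ N := by
    by_contra hgN
    exact hv (Subtype.ext (hdis g hgN v v.2 (hg ▸ W.smul_mem c v.2)))
  exact ⟨⟨g, hgN⟩, Subtype.ext hg⟩

/-- If `e` acts as an involution, the trace of an element commuting with `e` on the `1`-eigenspace
of `e` is determined by traces on the whole space. -/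
theorem trace_stableSubrep_eigenspace_one [FiniteDimensional F V] (h2 : (2 : F) ≠ 0) {e : G}
    (he : ∀ v, ρ e (ρ e v) = v) (g : ρ.commutingSubgroup (ρ e)) :
    LinearMap.trace F _ ((ρ.stableSubrep _ (End.eigenspace (ρ e) (1 : F))
      Representation.eigenspace_stable).toRepresentation g) =
    2⁻¹ * (LinearMap.trace F V (ρ g) + LinearMap.trace F V (ρ (g * e))) := by
  let f : V →ₗ[F] V := (2 : F)⁻¹ • (ρ g + ρ (g * e))
  have hf : ∀ v, f v ∈ End.eigenspace (ρ e) (1 : F) := by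
    intro v
    have h1 : ρ e (ρ g v) = ρ g (ρ e v) := (g.2 v).symm
    rw [End.mem_eigenspace_iff]
    simp only [f, LinearMap.smul_apply, LinearMap.add_apply, map_smul, map_add, one_smul]
    rw [← ρ.apply_mul_apply, h1, ← g.2 (ρ e v), he, add_comm]
  have h := LinearMap.trace_restrict_eq_of_forall_mem (End.eigenspace (ρ e) (1 : F)) f hf
  rw [map_smul, map_add, smul_eq_mul] at h
  rw [← h]
  congr 1
  ext v
  have hv : ρ e v = v := by simpa using End.mem_eigenspace_iff.1 v.2
  change ρ g v = (2 : F)⁻¹ • (ρ g v + ρ (g * e) v)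
  rw [← ρ.apply_mul_apply, hv, ← two_smul F, smul_smul, inv_mul_cancel₀ h2, one_smul]

theorem HasOddPowerTrace.stableSubrep_eigenspace_one [FiniteDimensional F V]
    (hρ : HasOddPowerTrace ρ) (h2 : (2 : F) ≠ 0) {e : G} (he : ∀ v, ρ e (ρ e v) = v) :
    HasOddPowerTrace (ρ.stableSubrep _ (End.eigenspace (ρ e) (1 : F))
      Representation.eigenspace_stable).toRepresentation := by
  intro g k hk
  rw [trace_stableSubrep_eigenspace_one h2 he, trace_stableSubrep_eigenspace_one h2 he]
  have h1 : ρ ((g : G) ^ k * e) = ρ ((g * e) ^ k) := by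
    have hcomm : Commute (ρ g) (ρ e) := LinearMap.ext fun v => g.2 v
    have hee : ρ e ^ 2 = 1 := by
      rw [pow_two]
      exact LinearMap.ext he
    obtain ⟨m, rfl⟩ := hk
    rw [map_mul, map_pow, map_pow, map_mul, hcomm.mul_pow, pow_succ (ρ e), pow_mul (ρ e), hee,
      one_pow, one_mul]
  rw [Subgroup.coe_pow, hρ _ _ hk, h1, hρ _ _ hk]

end Splitting

/-! ### `2`-groups without a normal four-group containing a given central involution -/

section CyclicCentralizer

variable {G : Type*} [Group G]

theorem Subgroup.normal_zpowers_of_conj_mem {a : G}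
    (h : ∀ g, g * a * g⁻¹ ∈ Subgroup.zpowers a) : (Subgroup.zpowers a).Normal where
  conj_mem := by
    rintro _ ⟨k, rfl⟩ g
    rw [← conj_zpow]
    exact Subgroup.zpow_mem _ (h g) k

theorem mem_zpowers_zpow_of_odd [Finite G] (hG : IsPGroup 2 G) (a : G) {j : ℤ} (hj : Odd j) :
    a ∈ Subgroup.zpowers (a ^ j) := by
  obtain ⟨n, hn⟩ := hG a
  obtain ⟨m, rfl⟩ := hj
  obtain ⟨x, y, hxy⟩ : IsCoprime (2 * m + 1) ((2 : ℤ) ^ n) :=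
    IsCoprime.pow_right ⟨1, -m, by ring⟩
  refine ⟨x, ?_⟩
  have h1 : a ^ ((2 : ℤ) ^ n) = 1 := by exact_mod_cast hn
  calc (a ^ (2 * m + 1)) ^ x = a ^ (x * (2 * m + 1)) * (a ^ ((2 : ℤ) ^ n)) ^ y := by
        rw [h1, one_zpow, mul_one, ← zpow_mul, mul_comm]
    _ = a := by rw [← zpow_mul, ← zpow_add, mul_comm ((2 : ℤ) ^ n), hxy, zpow_one]

variable {z a b : G}

/-- If `z` is the only involution in a normal cyclic subgroup, and `b² = z` for an element `b` of
it, then an element centralising `b` cannot invert elements of order greater than two. -/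
theorem sq_eq_one_of_conj_eq_inv (hG : IsPGroup 2 G)
    (hinv : ∀ e ∈ Subgroup.zpowers a, e ^ 2 = 1 → e = 1 ∨ e = z)
    (hb : b ∈ Subgroup.zpowers a) (hb2 : b ^ 2 = z) (hz : z ≠ 1) (hz2 : z ^ 2 = 1)
    {x y : G} (hx : x ∈ Subgroup.zpowers a) (hyb : Commute y b) (hyx : y * x * y⁻¹ = x⁻¹) :
    x ^ 2 = 1 := by
  by_contra hx2
  obtain ⟨n, hn1, hn2⟩ := hG.exists_pow_two_pow_involution hx2
  set t := x ^ 2 ^ n with ht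
  have htA : t ∈ Subgroup.zpowers a := Subgroup.pow_mem _ hx _
  have ht2 : t ^ 2 = z := by
    have h1 : t ^ 2 = (x ^ 2) ^ 2 ^ n := by rw [ht, ← pow_mul, ← pow_mul, mul_comm]
    rw [← h1] at hn1 hn2
    exact (hinv _ (Subgroup.pow_mem _ htA 2) hn2).resolve_left hn1
  have hcomm : Commute t b := by
    obtain ⟨i, hi⟩ := htA
    obtain ⟨j, hj⟩ := hb
    simp only at hi hj
    rw [← hi, ← hj]
    exact (Commute.refl a).zpow_zpow i j
  have htb : (t * b) ^ 2 = 1 := by rw [hcomm.mul_pow, ht2, hb2, ← pow_two, hz2]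
  have hyt : Commute y t := by
    have hyz : Commute y z := hb2 ▸ hyb.pow_right 2
    rcases hinv _ (Subgroup.mul_mem _ htA hb) htb with h | h
    · rw [eq_inv_of_mul_eq_one_left h]
      exact hyb.inv_right
    · rw [eq_mul_inv_of_mul_eq h]
      exact hyz.mul_right hyb.inv_right
  have h1 : y * t * y⁻¹ = t⁻¹ := by rw [ht, ← conj_pow, hyx, inv_pow]
  rw [hyt.eq, mul_inv_cancel_right] at h1
  refine hz ?_
  rw [← ht2, pow_two]
  nth_rewrite 2 [h1]
  exact mul_inv_cancel t

/-- Let `z` be a central involution of a finite `2`-group `G` which has no normal four-group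
containing `z`, and suppose that `z` is not the square of a central element and that
`G ≠ ⟨z⟩`. Then `G` has a normal cyclic subgroup `⟨a⟩` which contains a square root `b` of `z` and
is the centraliser of `b`; it has index two because the conjugates of `b` are `b` and `z * b`. -/
theorem exists_cyclic_centralizer [Finite G] (hG : IsPGroup 2 G)
    (hz : z ≠ 1) (hz2 : z ^ 2 = 1) (hzc : ∀ g, Commute g z)
    (hne : ∀ e : G, e ^ 2 = 1 → (∀ g, g * e * g⁻¹ = e ∨ g * e * g⁻¹ = z * e) → e = 1 ∨ e = z)
    (hnc : ∀ c : G, c ^ 2 = z → ∃ g, ¬ Commute g c) (hbig : ∃ g : G, g ≠ 1 ∧ g ≠ z) :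
    ∃ a b s : G, (Subgroup.zpowers a).Normal ∧ b ∈ Subgroup.zpowers a ∧ b ^ 2 = z ∧
      (∀ e ∈ Subgroup.zpowers a, e ^ 2 = 1 → e = 1 ∨ e = z) ∧
      (∀ g, g * b * g⁻¹ = b ∨ g * b * g⁻¹ = z * b) ∧ s * b * s⁻¹ = z * b ∧
      ∀ g, Commute g b ↔ g ∈ Subgroup.zpowers a := by
  have hmemz : ∀ g, g ∈ Subgroup.zpowers z ↔ g = 1 ∨ g = z := by
    intro g
    constructor
    · rintro ⟨k, rfl⟩
      rcases Int.even_or_odd' k with ⟨m, rfl | rfl⟩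
      · left
        change z ^ (2 * m) = 1
        rw [zpow_mul, zpow_ofNat, hz2, one_zpow]
      · right
        change z ^ (2 * m + 1) = z
        rw [zpow_add, zpow_mul, zpow_ofNat, hz2, one_zpow, one_mul, zpow_one]
    · rintro (rfl | rfl)
      · exact Subgroup.one_mem _
      · exact Subgroup.mem_zpowers _
  -- `b` is an element of order two modulo `z`, central modulo `z`
  obtain ⟨b, hb2, hbconj⟩ : ∃ b : G, b ^ 2 = z ∧ ∀ g, g * b * g⁻¹ = b ∨ g * b * g⁻¹ = z * b := by
    have hzn : (Subgroup.zpowers z).Normal := Subgroup.normal_zpowers_of_conj_mem fun g => by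
      rw [(hzc g).eq, mul_inv_cancel_right]
      exact Subgroup.mem_zpowers z
    obtain ⟨g₀, hg1, hgz⟩ := hbig
    obtain ⟨y, -, hyN, hy2, hyc⟩ := hG.exists_central_involution_mod (N := Subgroup.zpowers z)
      (M := ⊤) fun h => (not_or.2 ⟨hg1, hgz⟩) ((hmemz g₀).1 (h (Subgroup.mem_top g₀)))
    have hconj : ∀ g, g * y * g⁻¹ = y ∨ g * y * g⁻¹ = z * y := fun g =>
      ((hmemz _).1 (hyc g)).imp mul_inv_eq_one.1 mul_inv_eq_iff_eq_mul.1
    refine ⟨y, ((hmemz _).1 hy2).resolve_left fun h1 => ?_, hconj⟩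
    exact hyN ((hmemz y).2 (hne y h1 hconj))
  obtain ⟨s, hs⟩ : ∃ s, s * b * s⁻¹ = z * b := by
    obtain ⟨s, hs⟩ := hnc b hb2
    exact ⟨s, (hbconj s).resolve_left fun h => hs (mul_inv_eq_iff_eq_mul.1 h)⟩
  -- `a` generates a cyclic normal subgroup of maximal order containing `b`
  obtain ⟨a, ⟨hAn, hbA⟩, hmax⟩ := Set.exists_max_image
    {a : G | (Subgroup.zpowers a).Normal ∧ b ∈ Subgroup.zpowers a} orderOf (Set.toFinite _)
    ⟨b, Subgroup.normal_zpowers_of_conj_mem fun g => by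
      rcases hbconj g with h | h
      · rw [h]
        exact Subgroup.mem_zpowers b
      · rw [h, ← hb2, ← pow_succ]
        exact Subgroup.npow_mem_zpowers b 3, Subgroup.mem_zpowers b⟩
  have hinv : ∀ e ∈ Subgroup.zpowers a, e ^ 2 = 1 → e = 1 ∨ e = z := by
    rintro e ⟨k, rfl⟩ he
    refine hne _ he fun g => Or.inl ?_
    obtain ⟨u, hu⟩ := hAn.conj_mem a (Subgroup.mem_zpowers a) g
    simp only at hu he ⊢
    have h1 : g * a ^ k * g⁻¹ = (a ^ k) ^ u := by
      rw [← conj_zpow, ← hu, ← zpow_mul, ← zpow_mul, mul_comm]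
    rcases Int.even_or_odd' u with ⟨m, rfl | rfl⟩
    · rw [zpow_mul, zpow_ofNat, he, one_zpow] at h1
      have h2 : a ^ k = 1 := by
        rw [mul_inv_eq_one] at h1
        exact mul_eq_left.1 h1
      rw [h2, mul_one, mul_inv_cancel]
    · rw [h1, zpow_add, zpow_mul, zpow_ofNat, he, one_zpow, one_mul, zpow_one]
  have hAcomm : ∀ x ∈ Subgroup.zpowers a, ∀ y ∈ Subgroup.zpowers a, Commute x y := by
    rintro _ ⟨i, rfl⟩ _ ⟨j, rfl⟩
    exact (Commute.refl a).zpow_zpow i j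
  have hzA : z ∈ Subgroup.zpowers a := hb2 ▸ Subgroup.pow_mem _ hbA 2
  -- an involution outside `⟨a⟩`, central modulo `⟨a⟩`, whose commutators have order at most two
  have hnoinv : ∀ y x : G, x ∈ Subgroup.zpowers a → y ∉ Subgroup.zpowers a →
      (∀ g, g * y * g⁻¹ * y⁻¹ ∈ Subgroup.zpowers a) → (y * x) ^ 2 = 1 →
      (∀ c ∈ Subgroup.zpowers a, (c * (y * x)) ^ 2 = 1 → c ^ 2 = 1) → False := by
    intro y x hx hy hyc h2 hc
    have hcA : ∀ g, g * (y * x) * g⁻¹ * (y * x)⁻¹ ∈ Subgroup.zpowers a := by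
      intro g
      have h3 : g * (y * x) * g⁻¹ * (y * x)⁻¹ =
          (g * y * g⁻¹ * y⁻¹) * (y * (g * x * g⁻¹ * x⁻¹) * y⁻¹) := by group
      rw [h3]
      exact Subgroup.mul_mem _ (hyc g) (hAn.conj_mem _ (Subgroup.mul_mem _
        (hAn.conj_mem x hx g) (Subgroup.inv_mem _ hx)) y)
    have h4 := hne (y * x) h2 fun g => by
      have h5 : (g * (y * x) * g⁻¹ * (y * x)⁻¹ * (y * x)) ^ 2 = 1 := by
        rw [inv_mul_cancel_right, conj_pow, h2, mul_one, mul_inv_cancel]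
      exact (hinv _ (hcA g) (hc _ (hcA g) h5)).imp mul_inv_eq_one.1 mul_inv_eq_iff_eq_mul.1
    refine hy ((Subgroup.mul_mem_cancel_right _ hx).1 ?_)
    rcases h4 with h | h <;> rw [h]
    · exact Subgroup.one_mem _
    · exact hzA
  -- `⟨a⟩` is its own centraliser, by maximality
  have hcenA : ∀ g, Commute g a → g ∈ Subgroup.zpowers a := by
    by_contra! hcon
    obtain ⟨g₀, hg₀, hg₀A⟩ := hcon
    have hmemc : ∀ g, g ∈ Subgroup.centralizer (Subgroup.zpowers a : Set G) ↔ Commute g a := by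
      intro g
      rw [Subgroup.mem_centralizer_iff]
      constructor
      · exact fun h => (h a (Subgroup.mem_zpowers a)).symm
      · rintro h _ ⟨k, rfl⟩
        exact (h.zpow_right k).symm
    obtain ⟨y, hyM, hyN, ⟨j, hj⟩, hyc⟩ := hG.exists_central_involution_mod
      (N := Subgroup.zpowers a) (M := Subgroup.centralizer (Subgroup.zpowers a : Set G))
      fun h => hg₀A (h ((hmemc g₀).2 hg₀))
    have hya : Commute y a := (hmemc y).1 hyM
    simp only at hj
    rcases Int.even_or_odd j with hje | hjo
    · obtain ⟨m, rfl⟩ := hje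
      have hyx : ∀ x ∈ Subgroup.zpowers a, Commute x y := by
        rintro _ ⟨k, rfl⟩
        exact (hya.zpow_right k).symm
      refine hnoinv y (a ^ (-m)) (Subgroup.zpow_mem_zpowers a _) hyN hyc ?_ fun c hc h => ?_
      · rw [(hya.zpow_right _).mul_pow, ← hj, pow_two, ← zpow_add, ← zpow_add]
        simp
      · have h2 : (y * a ^ (-m)) ^ 2 = 1 := by
          rw [(hya.zpow_right _).mul_pow, ← hj, pow_two, ← zpow_add, ← zpow_add]
          simp
        rwa [((hyx c hc).mul_right (hAcomm c hc _ (Subgroup.zpow_mem_zpowers a _))).mul_pow, h2,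
          mul_one] at h
    · have hay : a ∈ Subgroup.zpowers y := by
        have h1 := mem_zpowers_zpow_of_odd hG a hjo
        rw [hj] at h1
        exact Subgroup.zpowers_le.2 (Subgroup.npow_mem_zpowers y 2) h1
      have hle : Subgroup.zpowers a ≤ Subgroup.zpowers y := Subgroup.zpowers_le.2 hay
      have h1 := hmax y ⟨Subgroup.normal_zpowers_of_conj_mem fun g => by
        rw [← inv_mul_cancel_right (g * y * g⁻¹) y]
        exact Subgroup.mul_mem _ (hle (hyc g)) (Subgroup.mem_zpowers y), hle hbA⟩
      rw [← Nat.card_zpowers, ← Nat.card_zpowers] at h1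
      exact hyN (Subgroup.eq_of_le_of_card_ge hle h1 ▸ Subgroup.mem_zpowers y)
  -- an element centralising `b` acts on `⟨a⟩` trivially or by `a ↦ z * a`
  refine ⟨a, b, s, hAn, hbA, hb2, hinv, hbconj, hs, fun g => ⟨fun hg => ?_, fun hg =>
    hAcomm g hg b hbA⟩⟩
  by_contra hgA
  have hmemc : ∀ g, g ∈ Subgroup.centralizer (Subgroup.zpowers b : Set G) ↔ Commute g b := by
    intro g
    rw [Subgroup.mem_centralizer_iff]
    constructor
    · exact fun h => (h b (Subgroup.mem_zpowers b)).symm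
    · rintro h _ ⟨k, rfl⟩
      exact (h.zpow_right k).symm
  have hbn : (Subgroup.zpowers b).Normal := Subgroup.normal_zpowers_of_conj_mem fun g => by
    rcases hbconj g with h | h
    · rw [h]
      exact Subgroup.mem_zpowers b
    · rw [h, ← hb2, ← pow_succ]
      exact Subgroup.npow_mem_zpowers b 3
  obtain ⟨c, hcM, hcN, hc2, hcc⟩ := hG.exists_central_involution_mod
    (N := Subgroup.zpowers a) (M := Subgroup.centralizer (Subgroup.zpowers b : Set G))
    fun h => hgA (h ((hmemc g).2 hg))
  have hcb : Commute c b := (hmemc c).1 hcM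
  have hca : c * a * c⁻¹ = z * a := by
    have htA : c * a * c⁻¹ * a⁻¹ ∈ Subgroup.zpowers a := Subgroup.mul_mem _
      (hAn.conj_mem a (Subgroup.mem_zpowers a) c) (Subgroup.inv_mem _ (Subgroup.mem_zpowers a))
    have h1 : c * (c * a * c⁻¹ * a⁻¹) * c⁻¹ = (c * a * c⁻¹ * a⁻¹)⁻¹ := by
      have h2 : c ^ 2 * a * (c ^ 2)⁻¹ = a := by
        rw [(hAcomm _ hc2 a (Subgroup.mem_zpowers a)).eq, mul_inv_cancel_right]
      calc c * (c * a * c⁻¹ * a⁻¹) * c⁻¹ = (c ^ 2 * a * (c ^ 2)⁻¹) * (c * a⁻¹ * c⁻¹) := by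
            rw [pow_two]
            group
        _ = _ := by
            rw [h2]
            group
    have h3 := sq_eq_one_of_conj_eq_inv hG hinv hbA hb2 hz hz2 htA hcb h1
    rcases hinv _ htA h3 with h | h
    · rw [mul_inv_eq_one, mul_inv_eq_iff_eq_mul] at h
      exact absurd (hcenA c h) hcN
    · exact mul_inv_eq_iff_eq_mul.1 h
  have hcak : ∀ k : ℤ, c * a ^ k * c⁻¹ = z ^ k * a ^ k := by
    intro k
    rw [← conj_zpow, hca, (hzc a).symm.mul_zpow]
  obtain ⟨k, hk⟩ := hc2
  simp only at hk
  obtain ⟨m, rfl⟩ : Even k := by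
    by_contra hodd
    obtain ⟨m, rfl⟩ := Int.not_even_iff_odd.1 hodd
    have h1 := hcak (2 * m + 1)
    rw [hk, pow_two, mul_assoc, mul_assoc, mul_inv_cancel, mul_one] at h1
    have h2 := mul_eq_right.1 h1.symm
    rw [zpow_add, zpow_mul, zpow_ofNat, hz2, one_zpow, one_mul, zpow_one] at h2
    exact hz h2
  have hy2 : (c * a ^ (-m)) ^ 2 = z ^ (-m) := by
    have h1 : c * a ^ (-m) = z ^ (-m) * a ^ (-m) * c := by rw [← hcak, inv_mul_cancel_right]
    have h2 : (c * a ^ (-m)) ^ 2 = z ^ (-m) * (a ^ (-m) * c ^ 2 * a ^ (-m)) := by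
      rw [pow_two]
      nth_rewrite 1 [h1]
      rw [pow_two]
      group
    rw [h2, ← hk, ← zpow_add, ← zpow_add]
    simp
  have hxc : ∃ x ∈ Subgroup.zpowers a, (c * x) ^ 2 = 1 := by
    rcases (hmemz _).1 (Subgroup.zpow_mem_zpowers z (-m)) with h | h
    · exact ⟨_, Subgroup.zpow_mem_zpowers a (-m), hy2.trans h⟩
    · refine ⟨a ^ (-m) * b, Subgroup.mul_mem _ (Subgroup.zpow_mem_zpowers a (-m)) hbA, ?_⟩
      rw [← mul_assoc, (hcb.mul_left
        (hAcomm _ (Subgroup.zpow_mem_zpowers a (-m)) b hbA)).mul_pow, hy2, h, hb2, ← pow_two, hz2]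
  obtain ⟨x, hx, hx2⟩ := hxc
  refine hnoinv c x hx hcN hcc hx2 fun t ht h => ?_
  refine sq_eq_one_of_conj_eq_inv hG hinv hbA hb2 hz hz2 ht (hcb.mul_left (hAcomm x hx b hbA)) ?_
  have h3 : t * (c * x * t * (c * x)⁻¹) * (c * x) ^ 2 = 1 := by
    rw [← h, pow_two, pow_two]
    group
  rw [hx2, mul_one] at h3
  exact eq_inv_of_mul_eq_one_right h3

end CyclicCentralizer

/-! ### Representations which do not split -/

section Unsplit

open Module

/-- If `p ^ d - 1` is a power of two, where `p ≡ 1 mod 4` and `d` is a power of two, then `d = 1`: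
otherwise `p ^ (d / 2) + 1 ≡ 2 mod 4` is a power of two greater than `2`. -/
theorem eq_one_of_pow_sub_one_eq_two_pow {p d n k : ℕ} (hp : p % 4 = 1) (hp1 : 1 < p)
    (hd : 2 * d = 2 ^ k) (h : p ^ d = 2 ^ n + 1) : d = 1 := by
  rcases Nat.even_or_odd' d with ⟨e, rfl | rfl⟩
  · have he : e ≠ 0 := by
      rintro rfl
      have := Nat.two_pow_pos k
      omega
    have hpe : p ^ e % 4 = 1 := by rw [Nat.pow_mod, hp, one_pow, Nat.one_mod]
    have h1 : (p ^ e + 1) * (p ^ e - 1) = 2 ^ n := by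
      have h2 := Nat.sq_sub_sq (p ^ e) 1
      rw [← h2, ← pow_mul, mul_comm e, h]
      simp
    obtain ⟨x, -, hx⟩ := (Nat.dvd_prime_pow Nat.prime_two).1 (Dvd.intro _ h1)
    have h3 : 1 < p ^ e := Nat.one_lt_pow he hp1
    rcases x with _ | _ | x
    · omega
    · omega
    · rw [pow_succ, pow_succ] at hx
      omega
  · rcases k with _ | _ | k
    · omega
    · omega
    · rw [pow_succ, pow_succ] at hd
      omega

/-- The endomorphisms of `F_p²` by which the elements of `Q8` act when `p = 5`; the entries of the
matrices are transported to `F_p` for an arbitrary `p`. -/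
def q8Endos (p : ℕ) : Set ((Fin 2 → ZMod p) →ₗ[ZMod p] (Fin 2 → ZMod p)) :=
  {T | ∃ q : Q8, T = Matrix.toLin' ((q8Matrix q).map ZMod.cast)}

theorem ZMod.eq_zero_of_four_mul : ∀ x : ZMod 5, 4 * x = 0 → x = 0 := by decide

theorem ZMod.three_eq_neg_two : (3 : ZMod 5) = -2 := by decide

theorem mem_q8Endos {T : (Fin 2 → ZMod 5) →ₗ[ZMod 5] (Fin 2 → ZMod 5)} :
    T ∈ q8Endos 5 ↔ ∃ q, T = q8Rep q := by
  have h : ∀ M : Matrix (Fin 2) (Fin 2) (ZMod 5), M.map ZMod.cast = M := fun M => by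
    ext i j
    simp
  simp only [q8Endos, Set.mem_ofPred_eq, h]
  rfl

variable {p : ℕ} [Fact p.Prime] {G V : Type*} [Group G] [AddCommGroup V]
  [Module (ZMod p) V] {ρ : Representation (ZMod p) G V}

/-- If a `2`-group has the eigenvector property on a nonzero space over `F_p`, then `p - 1` is a
power of `2`. -/
theorem HasEigenvectorProperty.exists_sub_one_eq_two_pow [Nontrivial V] (hG : IsPGroup 2 G)
    (hρ : HasEigenvectorProperty ρ) : ∃ m, p - 1 = 2 ^ m := by
  obtain ⟨v, hv⟩ := exists_ne (0 : V)
  have hU : IsPGroup 2 (ZMod p)ˣ := by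
    intro u
    obtain ⟨g, hg⟩ := hρ v u u.ne_zero
    obtain ⟨n, hn⟩ := hG g
    refine ⟨n, Units.ext ?_⟩
    have h1 : ∀ k : ℕ, ρ (g ^ k) v = ((u : ZMod p) ^ k) • v := by
      intro k
      induction k with
      | zero => simp
      | succ k ih => rw [pow_succ, ← ρ.apply_mul_apply, hg, map_smul, ih, smul_smul, pow_succ']
    have h2 := h1 (2 ^ n)
    rw [hn, map_one, Module.End.one_apply] at h2
    have h3 : (((u : ZMod p) ^ 2 ^ n) - 1) • v = 0 := by rw [sub_smul, one_smul, ← h2, sub_self]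
    simpa using sub_eq_zero.1 ((smul_eq_zero.1 h3).resolve_right hv)
  obtain ⟨m, hm⟩ := IsPGroup.iff_card.1 hU
  refine ⟨m, ?_⟩
  rw [← hm, Nat.card_eq_fintype_card, ZMod.card_units]

theorem ZMod.two_ne_zero_of_five_le (hp : 5 ≤ p) : (2 : ZMod p) ≠ 0 := by
  intro h
  have h1 : ((2 : ℕ) : ZMod p) = 0 := by exact_mod_cast h
  have := Nat.le_of_dvd (by norm_num) ((ZMod.natCast_eq_zero_iff 2 p).1 h1)
  omega

/-- No element of a `2`-group with odd-power trace acts by a square root of `-1` commuting with an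
irreducible representation over `F_p` (`p ≡ 1 mod 4`): it would be a nonzero scalar with trace
equal to its negative. -/
theorem HasOddPowerTrace.false_of_central [Finite G] [FiniteDimensional (ZMod p) V]
    (hG : IsPGroup 2 G) (hirr : ρ.IsIrreducible) (htr : HasOddPowerTrace ρ) (hp : 5 ≤ p)
    {ι : ZMod p} (hι : ι * ι = -1) {c : G} (hc2 : ∀ v, ρ c (ρ c v) = -v)
    (hc : ∀ g, Commute g c) : False := by
  have h2 : (2 : ZMod p) ≠ 0 := ZMod.two_ne_zero_of_five_le hp
  obtain ⟨k, hk⟩ := Representation.IsIrreducible.finrank_eq_two_pow _ G V ρ hirr hG rfl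
  have key : ∀ μ : ZMod p, μ * μ = -1 → ¬ ∀ v, ρ c v = μ • v := by
    intro μ hμ h
    have hμ0 : μ ≠ 0 := by
      rintro rfl
      simp at hμ
    have e1 : ρ c = μ • LinearMap.id := LinearMap.ext fun v => by simpa using h v
    have e3 : ρ (c ^ 3) = (-μ) • LinearMap.id := LinearMap.ext fun v => by
      have : c ^ 3 = c * (c * c) := by rw [pow_succ, pow_two, mul_assoc]
      rw [this, ← ρ.apply_mul_apply, ← ρ.apply_mul_apply, hc2, h]
      simp
    have h1 := htr c 3 (by decide)
    rw [e1, e3, map_smul, map_smul, LinearMap.trace_id, hk] at h1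
    have h3 : (2 * μ) * ((2 : ZMod p) ^ k) = 0 := by
      push_cast [smul_eq_mul] at h1
      linear_combination -h1
    exact mul_ne_zero (mul_ne_zero h2 hμ0) (pow_ne_zero k h2) h3
  rcases hirr.eq_smul_or_eq_smul (T := ρ c) (α := ι) (β := -ι)
    (fun g v => by rw [ρ.apply_mul_apply, ρ.apply_mul_apply, (hc g).eq])
    (fun v => by
      rw [map_sub, hc2, map_smul, smul_sub, smul_smul, mul_neg, hι, neg_neg, one_smul, neg_smul]
      abel) with h | h
  · exact key ι hι h
  · exact key (-ι) (by rw [neg_mul_neg, hι]) h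

/-- The elements of a group generated by `b` and `s` as in `Q8` act in the basis `e₁`, `-s e₁` by
the standard matrices of `Q8`, if `e₁` is an eigenvector of `b` for the eigenvalue `2`. -/
theorem hasFrame_of_quaternion_action [Fact (Nat.Prime 5)] {G V : Type*} [Group G]
    [AddCommGroup V] [Module (ZMod 5) V] [FiniteDimensional (ZMod 5) V]
    {ρ : Representation (ZMod 5) G V} {b s : G} {e : V} (he : e ≠ 0)
    (hdim : finrank (ZMod 5) V = 2) (hbe : ρ b e = (2 : ZMod 5) • e) (hs : ∀ v, ρ s (ρ s v) = -v)
    (hbs : ∀ v, ρ b (ρ s v) = -ρ s (ρ b v))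
    (hgen : ∀ g, ∃ k : ℕ, g = b ^ k ∨ g = s * b ^ k) : HasFrame (q8Endos 5) ρ := by
  have hbse : ρ b (ρ s e) = (-2 : ZMod 5) • ρ s e := by rw [hbs, hbe, map_smul, neg_smul]
  have hse : ρ s e ≠ 0 := fun h => he ((ρ.apply_bijective s).1 (h.trans (map_zero _).symm))
  let ε : (Fin 2 → ZMod 5) →ₗ[ZMod 5] V :=
    (LinearMap.proj 0).smulRight e - (LinearMap.proj 1).smulRight (ρ s e)
  have hε : ∀ u, ε u = u 0 • e - u 1 • ρ s e := fun u => rfl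
  have hinj : Function.Injective ε := by
    rw [← LinearMap.ker_eq_bot, LinearMap.ker_eq_bot']
    intro u hu
    rw [hε] at hu
    -- applying `b` separates the two eigenvectors
    have h1 : (2 * u 0) • e + (2 * u 1) • ρ s e = 0 := by
      have := congrArg (ρ b) hu
      rw [map_sub, map_smul, map_smul, hbe, hbse, map_zero, smul_smul, smul_smul] at this
      rw [← this]
      module
    have h0 : u 0 = 0 := by
      have h2 : (4 * u 0) • e = 0 := by
        calc (4 * u 0) • e = ((2 * u 0) • e + (2 * u 1) • ρ s e) +
              (2 : ZMod 5) • (u 0 • e - u 1 • ρ s e) := by module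
          _ = 0 := by rw [h1, hu, smul_zero, add_zero]
      have h3 := (smul_eq_zero.1 h2).resolve_right he
      exact ZMod.eq_zero_of_four_mul (u 0) h3
    have h1 : u 1 = 0 := by
      rw [h0, zero_smul, zero_sub, neg_eq_zero] at hu
      exact (smul_eq_zero.1 hu).resolve_right hse
    funext i
    fin_cases i
    · exact h0
    · exact h1
  have hbij : Function.Bijective ε :=
    ⟨hinj, (LinearMap.injective_iff_surjective_of_finrank_eq_finrank (by simp [hdim])).1 hinj⟩
  have hb : ∀ u, ρ b (ε u) = ε (q8Rep (QuaternionGroup.a 1) u) := by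
    intro u
    have : q8Rep (QuaternionGroup.a 1) u = ![2 * u 0, 3 * u 1] := by
      change Matrix.toLin' (!![2, 0; 0, 3] ^ (1 : ZMod (2 * 2)).val) u = _
      rw [show (1 : ZMod (2 * 2)).val = 1 from rfl, pow_one]
      ext i
      fin_cases i <;> simp [Matrix.mulVec, Matrix.vecHead, Matrix.vecTail]
    rw [this, hε, hε, map_sub, map_smul, map_smul, hbe, hbse]
    simp only [Matrix.cons_val_zero, Matrix.cons_val_one, ZMod.three_eq_neg_two]
    module
  have hs' : ∀ u, ρ s (ε u) = ε (q8Rep (QuaternionGroup.xa 0) u) := by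
    intro u
    have : q8Rep (QuaternionGroup.xa 0) u = ![u 1, -u 0] := by
      change Matrix.toLin' (!![0, 1; -1, 0] * !![2, 0; 0, 3] ^ (0 : ZMod (2 * 2)).val) u = _
      rw [show (0 : ZMod (2 * 2)).val = 0 from rfl, pow_zero, mul_one]
      ext i
      fin_cases i <;> simp [Matrix.mulVec, Matrix.vecHead, Matrix.vecTail]
    rw [this, hε, hε, map_sub, map_smul, map_smul, hs]
    simp only [Matrix.cons_val_zero, Matrix.cons_val_one]
    module
  have hbk : ∀ k : ℕ, ∀ u, ρ (b ^ k) (ε u) = ε (q8Rep (QuaternionGroup.a 1 ^ k) u) := by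
    intro k
    induction k with
    | zero => simp
    | succ k ih =>
      intro u
      rw [pow_succ, ← ρ.apply_mul_apply, hb, ih, q8Rep.apply_mul_apply, pow_succ]
  refine ⟨Unit, inferInstance, fun _ => ε, ?_, fun g _ => ?_⟩
  · convert hbij.comp (Equiv.funUnique Unit (Fin 2 → ZMod 5)).bijective using 1
    funext u
    simp
  · obtain ⟨k, rfl | rfl⟩ := hgen g
    · exact ⟨(), _, mem_q8Endos.2 ⟨_, rfl⟩, hbk k⟩
    · refine ⟨(), _, mem_q8Endos.2 ⟨QuaternionGroup.xa 0 * QuaternionGroup.a 1 ^ k, rfl⟩,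
        fun u => ?_⟩
      rw [← ρ.apply_mul_apply, hbk, hs', q8Rep.apply_mul_apply]

end Unsplit

/-! ### Classification of the representations -/

section UnsplitClassification

open Module

theorem LinearMap.trace_eq_add_of_eigenvectors {F V : Type*} [Field F] [AddCommGroup V] [Module F V]
    [FiniteDimensional F V] (hdim : finrank F V = 2) {v w : V}
    (hli : LinearIndependent F ![v, w]) {T : V →ₗ[F] V} {α β : F} (hv : T v = α • v)
    (hw : T w = β • w) : LinearMap.trace F V T = α + β := by
  let B := basisOfLinearIndependentOfCardEqFinrank hli (by simp [hdim])
  have h0 : B 0 = v := by simp [B]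
  have h1 : B 1 = w := by simp [B]
  rw [LinearMap.trace_eq_matrix_trace F B, Matrix.trace_fin_two, LinearMap.toMatrix_apply,
    LinearMap.toMatrix_apply, h0, h1, hv, hw, ← h0, ← h1]
  simp

theorem ZMod.eq_two_or_eq_neg_two : ∀ x : ZMod 5, x * x = -1 → x = 2 ∨ x = -2 := by decide

theorem ZMod.exists_eq_two_pow (x : ZMod 5) (hx : x ≠ 0) : ∃ k : ℕ, x = 2 ^ k := by
  have : ∀ x : ZMod 5, x ≠ 0 → ∃ k : Fin 4, x = 2 ^ (k : ℕ) := by decide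
  obtain ⟨k, hk⟩ := this x hx
  exact ⟨k, hk⟩

theorem ZMod.two_mul_two : (2 : ZMod 5) * 2 = -1 := by decide

variable {p : ℕ} [Fact p.Prime] {G V : Type*} [Group G] [AddCommGroup V]
  [Module (ZMod p) V] {ρ : Representation (ZMod p) G V}

/-- The faithful irreducible representations with the eigenvector property and odd-power trace which
do not split are those of `Q8` for `p = 5`.

With `b` and `⟨a⟩` as in `exists_cyclic_centralizer`, the eigenvector property for the eigenvalue
`ι = √-1` makes `⟨a⟩` act regularly on the nonzero vectors of the `ι`-eigenspace of `b`, so `p ^ d`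
exceeds a power of two by one for its dimension `d`. This gives `d = 1`, and an element of order
eight in `⟨a⟩` would have nonzero trace. -/
theorem unsplit_faithful [Finite G] [FiniteDimensional (ZMod p) V] (hp : 5 ≤ p)
    (hG : IsPGroup 2 G) (hinj : Function.Injective ρ) (hirr : ρ.IsIrreducible)
    (htr : HasOddPowerTrace ρ) (heig : HasEigenvectorProperty ρ)
    (hne : ∀ e : G, (∀ v, ρ e (ρ e v) = v) →
      (∀ g, (∀ v, ρ g (ρ e v) = ρ e (ρ g v)) ∨ ∀ v, ρ g (ρ e v) = -ρ e (ρ g v)) →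
      (∀ v, ρ e v = v) ∨ ∀ v, ρ e v = -v) :
    p = 5 ∧ HasFrame (q8Endos p) ρ := by
  have := hirr.nontrivial
  have h2 : (2 : ZMod p) ≠ 0 := ZMod.two_ne_zero_of_five_le hp
  have hneg : ∀ v : V, v = -v → v = 0 := by
    intro v hv
    have : (2 : ZMod p) • v = 0 := by
      rw [two_smul]
      nth_rewrite 2 [hv]
      exact add_neg_cancel v
    exact (smul_eq_zero.1 this).resolve_left h2
  have hext : ∀ g h : G, (∀ v, ρ g v = ρ h v) → g = h := fun g h hgh => hinj (LinearMap.ext hgh)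
  obtain ⟨m, hm⟩ := heig.exists_sub_one_eq_two_pow hG
  have hp4 : p % 4 = 1 := by
    rcases m with _ | _ | m
    · omega
    · omega
    · rw [pow_succ, pow_succ] at hm
      omega
  obtain ⟨ι, hι⟩ := ZMod.exists_sq_eq_neg_one_iff.2 (by omega : p % 4 ≠ 3)
  replace hι : ι * ι = -1 := hι.symm
  have hι0 : ι ≠ 0 := by
    rintro rfl
    simp at hι
  -- the central involution acts by `-1`
  obtain ⟨z, hzc, hz1, hz2⟩ : ∃ z : G, (∀ g, Commute g z) ∧ z ≠ 1 ∧ z ^ 2 = 1 := by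
    have : Nontrivial G := by
      by_contra hG1
      rw [not_nontrivial_iff_subsingleton] at hG1
      obtain ⟨v, hv⟩ := exists_ne (0 : V)
      obtain ⟨g, hg⟩ := heig v (-1) (by simp)
      rw [Subsingleton.elim g 1, map_one, neg_one_smul] at hg
      exact hv (hneg v hg)
    have := hG.center_nontrivial
    obtain ⟨y, hy⟩ := exists_ne (1 : Subgroup.center G)
    obtain ⟨n, hn1, hn2⟩ := (hG.to_subgroup (Subgroup.center G)).exists_pow_two_pow_involution hy
    exact ⟨_, fun g => Subgroup.mem_center_iff.1 (y ^ 2 ^ n).2 g, fun h => hn1 (Subtype.ext h),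
      congrArg Subtype.val hn2⟩
  have hρz : ∀ v, ρ z v = -v := by
    have hzz : ∀ v, ρ z (ρ z v) = v := fun v => by
      rw [ρ.apply_mul_apply, ← pow_two, hz2, map_one, Module.End.one_apply]
    rcases hirr.eq_smul_or_eq_smul (T := ρ z) (α := 1) (β := -1)
      (fun g v => by rw [ρ.apply_mul_apply, ρ.apply_mul_apply, (hzc g).eq])
      (fun v => by
        rw [map_sub, hzz, map_smul]
        module) with h | h
    · exact absurd (hext z 1 fun v => by rw [h, one_smul, map_one, Module.End.one_apply]) hz1
    · intro v
      rw [h, neg_one_smul]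
  have hρzg : ∀ g v, ρ (z * g) v = -ρ g v := fun g v => by rw [← ρ.apply_mul_apply, hρz]
  -- the group-theoretic structure
  obtain ⟨a, b, s, hAn, hbA, hb2, hinv, hbconj, hs, hbcomm⟩ := exists_cyclic_centralizer hG hz1 hz2
    hzc (fun e he2 he => by
      rcases hne e (fun v => by
          rw [ρ.apply_mul_apply, ← pow_two, he2, map_one, Module.End.one_apply])
        (fun g => (he g).imp
          (fun h v => by
            rw [ρ.apply_mul_apply, ρ.apply_mul_apply, mul_inv_eq_iff_eq_mul.1 h])
          (fun h v => by
            rw [ρ.apply_mul_apply, mul_inv_eq_iff_eq_mul.1 h, mul_assoc, hρzg,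
              ρ.apply_mul_apply])) with h | h
      · exact Or.inl (hext e 1 fun v => by rw [h, map_one, Module.End.one_apply])
      · exact Or.inr (hext e z fun v => by rw [h, hρz]))
    (fun c hc2 => by
      by_contra! hc
      refine htr.false_of_central hG hirr hp hι (c := c) (fun v => ?_) hc
      rw [ρ.apply_mul_apply, ← pow_two, hc2, hρz])
    (by
      obtain ⟨v, hv⟩ := exists_ne (0 : V)
      obtain ⟨g, hg⟩ := heig v ι hι0
      refine ⟨g, ?_, ?_⟩
      · rintro rfl
        rw [map_one, Module.End.one_apply] at hg
        refine hv (hneg v ?_)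
        rw [← neg_one_smul (ZMod p) v, ← hι, ← smul_smul, ← hg, ← hg]
      · rintro rfl
        rw [hρz] at hg
        refine hv (hneg v ?_)
        rw [← neg_one_smul (ZMod p) v, ← hι, ← smul_smul, ← hg, smul_neg, ← hg, neg_neg])
  have hsb : ∀ v, ρ b (ρ s v) = -ρ s (ρ b v) := by
    intro v
    have h1 : s * b = z * (b * s) := by rw [← mul_assoc]; exact mul_inv_eq_iff_eq_mul.1 hs
    rw [ρ.apply_mul_apply s b, h1, hρzg, neg_neg, ρ.apply_mul_apply]
  set N := Subgroup.zpowers a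
  set W : Submodule (ZMod p) V := End.eigenspace (ρ b) ι
  have hWmem : ∀ v, v ∈ W ↔ ρ b v = ι • v := fun v => End.mem_eigenspace_iff
  have hNeq : ρ.commutingSubgroup (ρ b) = N := by
    ext g
    rw [← hbcomm]
    constructor
    · intro h
      exact hext _ _ fun v => by rw [← ρ.apply_mul_apply, ← ρ.apply_mul_apply, h v]
    · intro h v
      rw [ρ.apply_mul_apply, ρ.apply_mul_apply, h.eq]
  have hsN : s ∉ N := by
    intro h
    rw [← hbcomm] at h
    rw [h.eq, mul_inv_cancel_right] at hs
    exact hz1 (mul_eq_right.1 hs.symm)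
  have hindex : N.index = 2 := by
    rw [← hNeq]
    refine Representation.commutingSubgroup_index (s := s) (fun g => (hbconj g).imp
      (fun h v => ?_) (fun h v => ?_)) (by rwa [hNeq])
    · rw [ρ.apply_mul_apply, ρ.apply_mul_apply, mul_inv_eq_iff_eq_mul.1 h]
    · rw [ρ.apply_mul_apply, mul_inv_eq_iff_eq_mul.1 h, mul_assoc, hρzg, ρ.apply_mul_apply]
  have hWstab : ∀ g ∈ N, ∀ v ∈ W, ρ g v ∈ W := by
    rw [← hNeq]
    exact Representation.eigenspace_stable
  obtain ⟨hWbot, hWtop⟩ := Representation.eigenspace_ne (ρ := ρ) (T := ρ b) (α := ι) (s := s)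
    (fun v => by rw [ρ.apply_mul_apply, ← pow_two, hb2, hρz, hι, neg_one_smul]) (by rwa [hNeq])
  have hcompl := hirr.isCompl_map hindex hsN hWstab hWbot hWtop
  have hsinj : ∀ x y, ρ s x = ρ s y → x = y := fun x y h => (ρ.apply_bijective s).1 h
  have huniq : ∀ x ∈ W, ∀ x' ∈ W, ∀ y ∈ W, ∀ y' ∈ W, x + ρ s y = x' + ρ s y' →
      x = x' ∧ y = y' := by
    intro x hx x' hx' y hy y' hy' h
    have h1 : x - x' = ρ s (y' - y) := by
      rw [map_sub, sub_eq_sub_iff_add_eq_add, h, add_comm]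
    have h3 : x - x' ∈ W ⊓ W.map (ρ s) :=
      ⟨W.sub_mem hx hx', h1 ▸ Submodule.mem_map_of_mem (W.sub_mem hy' hy)⟩
    rw [hcompl.inf_eq_bot, Submodule.mem_bot] at h3
    refine ⟨sub_eq_zero.1 h3, ?_⟩
    rw [h3] at h1
    exact (sub_eq_zero.1 (hsinj _ _ (h1.symm.trans (map_zero _).symm))).symm
  have hNconj : ∀ g ∈ N, s⁻¹ * g * s ∈ N := fun g hg => by
    simpa using hAn.conj_mem g hg s⁻¹
  have hgs : ∀ g v, ρ g (ρ s v) = ρ s (ρ (s⁻¹ * g * s) v) := by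
    intro g v
    rw [ρ.apply_mul_apply, ρ.apply_mul_apply]
    congr 2
    group
  have hfree : ∀ g ∈ N, ∀ w, w ≠ 0 → ρ g w = w → g = 1 := by
    intro g hg w hw hgw
    by_contra hg1
    obtain ⟨n, hn1, hn2⟩ := hG.exists_pow_two_pow_involution hg1
    have h1 := (hinv _ (Subgroup.pow_mem _ hg _) hn2).resolve_left hn1
    have h3 : ∀ k : ℕ, ρ (g ^ k) w = w := by
      intro k
      induction k with
      | zero => simp
      | succ k ih => rw [pow_succ, ← ρ.apply_mul_apply, hgw, ih]
    have h4 := h3 (2 ^ n)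
    rw [h1, hρz] at h4
    exact hw (hneg w h4.symm)
  have hfree' : ∀ g ∈ N, ∀ h ∈ N, ∀ w, w ≠ 0 → ρ g w = ρ h w → g = h := by
    intro g hg h hh w hw hgh
    have := hfree (h⁻¹ * g) (N.mul_mem (N.inv_mem hh) hg) w hw (by
      rw [← ρ.apply_mul_apply, hgh, ρ.apply_mul_apply, inv_mul_cancel, map_one,
        Module.End.one_apply])
    rw [inv_mul_eq_one] at this
    exact this.symm
  -- transitivity: apply the eigenvector property to `w₁ + s w₂`
  have htrans : ∀ w₁ ∈ W, w₁ ≠ 0 → ∀ w₂ ∈ W, w₂ ≠ 0 → ∃ g ∈ N, ρ g w₁ = w₂ := by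
    intro w₁ hw₁ hw₁0 w₂ hw₂ hw₂0
    obtain ⟨g, hg⟩ := heig (w₁ + ρ s w₂) ι hι0
    rw [map_add, smul_add, ← map_smul] at hg
    by_cases hgN : g ∈ N
    · exfalso
      rw [hgs] at hg
      obtain ⟨e1, e2⟩ := huniq _ (hWstab g hgN w₁ hw₁) _ (W.smul_mem ι hw₁) _
        (hWstab _ (hNconj g hgN) w₂ hw₂) _ (W.smul_mem ι hw₂) hg
      have hgb : g * b = z := by
        refine hfree' _ (N.mul_mem hgN hbA) _ (hb2 ▸ N.pow_mem hbA 2) w₁ hw₁0 ?_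
        rw [← ρ.apply_mul_apply, (hWmem w₁).1 hw₁, map_smul, e1, smul_smul, hι, hρz, neg_one_smul]
      have h1 : ρ (g * b) (ρ s w₂) = ρ s w₂ := by
        rw [← ρ.apply_mul_apply, hsb, (hWmem w₂).1 hw₂, map_smul, map_neg, map_smul, hgs, e2,
          map_smul, smul_smul, hι, neg_one_smul, neg_neg]
      rw [hgb, hρz] at h1
      exact hw₂0 (hsinj _ _ ((hneg _ h1.symm).trans (map_zero _).symm))
    · have hgs' : s⁻¹ * g ∈ N := mul_mem_of_index_two hindex hgN (by simpa using hsN)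
      have hgs'' : g * s ∈ N := mul_mem_of_index_two hindex hsN hgN
      have e0 : ρ g w₁ = ρ s (ρ (s⁻¹ * g) w₁) := by
        rw [ρ.apply_mul_apply, mul_inv_cancel_left]
      rw [e0, ρ.apply_mul_apply g s, add_comm] at hg
      obtain ⟨-, e2⟩ := huniq _ (hWstab _ hgs'' w₂ hw₂) _ (W.smul_mem ι hw₁) _
        (hWstab _ hgs' w₁ hw₁) _ (W.smul_mem ι hw₂) hg
      refine ⟨s⁻¹ * g * b * z, N.mul_mem (N.mul_mem hgs' hbA) (hb2 ▸ N.pow_mem hbA 2), ?_⟩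
      rw [← ρ.apply_mul_apply, hρz, ← ρ.apply_mul_apply, map_neg, (hWmem w₁).1 hw₁, map_neg,
        map_smul, e2, smul_smul, hι, neg_one_smul, neg_neg]
  obtain ⟨w, hwW, hw0⟩ := Submodule.exists_mem_ne_zero_of_ne_bot hWbot
  -- counting the nonzero vectors of `W`
  have hVW := hirr.finrank_eq_two_mul hindex hsN hWstab hWbot hWtop
  have hWcard : p ^ finrank (ZMod p) W = Nat.card N + 1 := by
    have : Finite V := Module.finite_of_finite (ZMod p)
    have e : N ≃ ({(0 : W)}ᶜ : Set W) := Equiv.ofBijective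
      (fun g => ⟨⟨ρ g w, hWstab g g.2 w hwW⟩, fun h => hw0 ((ρ.apply_bijective g).1
        ((congrArg Subtype.val h).trans (map_zero _).symm))⟩)
      ⟨fun g h hgh => Subtype.ext (hfree' g g.2 h h.2 w hw0
          (congrArg (fun x : ({(0 : W)}ᶜ : Set W) => ((x : W) : V)) hgh)),
        fun x => by
          obtain ⟨g, hg, hgx⟩ := htrans w hwW hw0 x x.1.2 fun h => x.2 (Subtype.ext h)
          exact ⟨⟨g, hg⟩, Subtype.ext (Subtype.ext hgx)⟩⟩
    have h1 : Nat.card W = p ^ finrank (ZMod p) W := by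
      rw [Module.natCard_eq_pow_finrank (K := ZMod p), Nat.card_zmod]
    rw [Nat.card_congr e, ← h1, Nat.card_coe_set_eq, ← Set.ncard_singleton (0 : W), add_comm,
      Set.ncard_add_ncard_compl]
  obtain ⟨n, hn⟩ := IsPGroup.iff_card.1 (hG.to_subgroup N)
  obtain ⟨k, hk⟩ := Representation.IsIrreducible.finrank_eq_two_pow _ G V ρ hirr hG rfl
  have hd : finrank (ZMod p) W = 1 := eq_one_of_pow_sub_one_eq_two_pow hp4 (by omega)
    (hVW ▸ hk) (hn ▸ hWcard)
  have hV2 : finrank (ZMod p) V = 2 := by rw [hVW, hd]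
  have hspan : ∀ v ∈ W, ∃ c : ZMod p, v = c • w := by
    intro v hv
    obtain ⟨c, hc⟩ := (finrank_eq_one_iff_of_nonzero' (⟨w, hwW⟩ : W)
      (fun h => hw0 (congrArg Subtype.val h))).1 hd ⟨v, hv⟩
    exact ⟨c, (congrArg Subtype.val hc).symm⟩
  have hsw0 : ρ s w ≠ 0 := fun h => hw0 (hsinj _ _ (h.trans (map_zero _).symm))
  have hswW : ρ s w ∉ W := fun h => hw0
    (huniq _ W.zero_mem _ h _ hwW _ W.zero_mem (by simp)).2
  -- `8 ∤ p - 1`: otherwise an element of order eight contradicts the trace condition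
  have hp5 : p = 5 := by
    have hp8 : ¬ 8 ∣ p - 1 := by
      rintro ⟨l, hl⟩
      obtain ⟨ζ, hζ⟩ := (ZMod.euler_criterion p hι0).2 (by
        have h4 : ι ^ 4 = 1 := by linear_combination (ι * ι - 1) * hι
        rw [show p / 2 = 4 * l by omega, pow_mul, h4, one_pow])
      have hζ0 : ζ ≠ 0 := by
        rintro rfl
        exact hι0 (by rw [hζ, mul_zero])
      obtain ⟨x, hx, hxw⟩ := htrans w hwW hw0 (ζ • w) (W.smul_mem ζ hwW) (smul_ne_zero hζ0 hw0)
      obtain ⟨ξ, hξ⟩ := hspan _ (hWstab _ (hNconj x hx) w hwW)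
      have hxs : ρ x (ρ s w) = ξ • ρ s w := by rw [hgs, hξ, map_smul]
      have hx2 : x * x = b := hfree' _ (N.mul_mem hx hx) _ hbA w hw0 (by
        rw [← ρ.apply_mul_apply, hxw, map_smul, hxw, smul_smul, ← hζ, (hWmem w).1 hwW])
      have hli : LinearIndependent (ZMod p) ![w, ρ s w] := by
        rw [LinearIndependent.pair_iff]
        intro c d hcd
        obtain ⟨e1, e2⟩ := huniq _ (W.smul_mem c hwW) _ W.zero_mem _ (W.smul_mem d hwW) _
          W.zero_mem (by rw [map_smul, hcd, map_zero, add_zero])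
        exact ⟨(smul_eq_zero.1 e1).resolve_right hw0, (smul_eq_zero.1 e2).resolve_right hw0⟩
      have ht := LinearMap.trace_eq_add_of_eigenvectors hV2 hli hxw hxs
      have ht5 := htr x 5 (by decide)
      have hx5 : ρ (x ^ 5) = -ρ x := by
        have : x ^ 5 = z * x := by
          rw [← hb2, ← hx2]
          simp only [pow_succ, pow_zero, one_mul, mul_assoc]
        exact LinearMap.ext fun v => by rw [this, hρzg, LinearMap.neg_apply]
      rw [hx5, map_neg, ht] at ht5
      have hξζ : ξ = -ζ := by
        have : 2 * (ζ + ξ) = 0 := by linear_combination -ht5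
        exact eq_neg_of_add_eq_zero_right ((mul_eq_zero.1 this).resolve_left h2)
      have h1 : ρ (x * x) (ρ s w) = ι • ρ s w := by
        rw [← ρ.apply_mul_apply, hxs, map_smul, hxs, smul_smul, hξζ, neg_mul_neg, hζ]
      rw [hx2, hsb, (hWmem w).1 hwW, map_smul] at h1
      exact smul_ne_zero hι0 hsw0 (hneg _ h1.symm)
    rcases m with _ | _ | _ | m
    · omega
    · omega
    · omega
    · refine absurd ⟨2 ^ m, ?_⟩ hp8
      rw [hm, pow_succ, pow_succ, pow_succ]
      ring
  refine ⟨hp5, ?_⟩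
  subst hp5
  -- replace `b` by `z * b` if necessary
  obtain ⟨c, hcN, hcw, hcs⟩ : ∃ c ∈ N, ρ c w = (2 : ZMod 5) • w ∧
      ∀ v, ρ c (ρ s v) = -ρ s (ρ c v) := by
    rcases ZMod.eq_two_or_eq_neg_two ι hι with h | h
    · exact ⟨b, hbA, by rw [(hWmem w).1 hwW, h], hsb⟩
    · refine ⟨z * b, N.mul_mem (hb2 ▸ N.pow_mem hbA 2) hbA, ?_, fun v => ?_⟩
      · rw [hρzg, (hWmem w).1 hwW, h, neg_smul, neg_neg]
      · rw [hρzg, hρzg, map_neg, hsb]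
  have hcks : ∀ (k : ℕ) v, ρ (c ^ k) (ρ s v) = (-1 : ZMod 5) ^ k • ρ s (ρ (c ^ k) v) := by
    intro k
    induction k with
    | zero => simp
    | succ k ih =>
      intro v
      rw [pow_succ, ← ρ.apply_mul_apply, hcs, map_neg, ih, ρ.apply_mul_apply _ c v, pow_succ]
      module
  have hckw : ∀ k : ℕ, ρ (c ^ k) w = (2 : ZMod 5) ^ k • w := by
    intro k
    induction k with
    | zero => simp
    | succ k ih => rw [pow_succ, ← ρ.apply_mul_apply, hcw, map_smul, ih, smul_smul, pow_succ']
  have hNgen : ∀ g ∈ N, ∃ k : ℕ, g = c ^ k := by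
    intro g hg
    obtain ⟨d, hd⟩ := hspan _ (hWstab g hg w hwW)
    have hd0 : d ≠ 0 := by
      rintro rfl
      rw [zero_smul] at hd
      exact hw0 ((ρ.apply_bijective g).1 (hd.trans (map_zero _).symm))
    obtain ⟨k, rfl⟩ := ZMod.exists_eq_two_pow d hd0
    exact ⟨k, hfree' g hg _ (N.pow_mem hcN k) w hw0 (hd.trans (hckw k).symm)⟩
  have hgen : ∀ g, ∃ k : ℕ, g = c ^ k ∨ g = s * c ^ k := by
    intro g
    by_cases hg : g ∈ N
    · obtain ⟨k, hk⟩ := hNgen g hg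
      exact ⟨k, Or.inl hk⟩
    · obtain ⟨k, hk⟩ := hNgen (s⁻¹ * g) (mul_mem_of_index_two hindex hg (by simpa using hsN))
      exact ⟨k, Or.inr (by rw [← hk, mul_inv_cancel_left])⟩
  have hc2 : c * c = z := hfree' _ (N.mul_mem hcN hcN) _ (hb2 ▸ N.pow_mem hbA 2) w hw0 (by
    rw [← ρ.apply_mul_apply, hcw, map_smul, hcw, smul_smul, ZMod.two_mul_two, hρz, neg_one_smul])
  -- `s ^ 2 = 1` is excluded because the representation does not split along `s`
  have hss : s * s = z := by
    obtain ⟨k, hk⟩ := hNgen _ (sq_mem_of_index_two hindex s)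
    have hkeven : Even k := by
      by_contra hodd
      rw [Nat.not_even_iff_odd] at hodd
      have h1 : ρ (s * s) (ρ s w) = ρ s (ρ (s * s) w) := by
        rw [ρ.apply_mul_apply, ρ.apply_mul_apply, mul_assoc]
      rw [hk, hcks, hodd.neg_one_pow, neg_one_smul] at h1
      have h3 := hsinj _ _ ((hneg _ h1.symm).trans (map_zero (ρ s)).symm)
      exact hw0 ((ρ.apply_bijective (c ^ k)).1 (h3.trans (map_zero _).symm))
    obtain ⟨j, rfl⟩ := hkeven
    rw [← two_mul, pow_mul, pow_two, hc2] at hk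
    rcases Nat.even_or_odd' j with ⟨i, rfl | rfl⟩
    · exfalso
      rw [pow_mul, hz2, one_pow] at hk
      have h1 : ∀ v, ρ s (ρ s v) = v := fun v => by
        rw [ρ.apply_mul_apply, hk, map_one, Module.End.one_apply]
      rcases hne s h1 (fun g => by
        obtain ⟨k, rfl | rfl⟩ := hgen g
        · refine (neg_one_pow_eq_or (ZMod 5) k).imp (fun h v => ?_) (fun h v => ?_)
          · rw [hcks, h, one_smul]
          · rw [hcks, h, neg_one_smul]
        · refine (neg_one_pow_eq_or (ZMod 5) k).imp (fun h v => ?_) (fun h v => ?_)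
          · rw [← ρ.apply_mul_apply, hcks, h, one_smul, ← ρ.apply_mul_apply s]
          · rw [← ρ.apply_mul_apply, hcks, h, neg_one_smul, map_neg, ← ρ.apply_mul_apply s])
        with h | h
      · exact hswW (by rw [h w]; exact hwW)
      · exact hswW (by rw [h w]; exact W.neg_mem hwW)
    · rw [hk, pow_succ, pow_mul, hz2, one_pow, one_mul]
  exact hasFrame_of_quaternion_action hw0 hV2 hcw
    (fun v => by rw [ρ.apply_mul_apply, hss, hρz]) hcs hgen

/-- The classification of `unsplit_faithful` without faithfulness. -/
theorem unsplit_classification [Finite G] [FiniteDimensional (ZMod p) V] (hp : 5 ≤ p)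
    (hG : IsPGroup 2 G) (hirr : ρ.IsIrreducible)
    (htr : HasOddPowerTrace ρ) (heig : HasEigenvectorProperty ρ)
    (hne : ∀ e : G, (∀ v, ρ e (ρ e v) = v) →
      (∀ g, (∀ v, ρ g (ρ e v) = ρ e (ρ g v)) ∨ ∀ v, ρ g (ρ e v) = -ρ e (ρ g v)) →
      (∀ v, ρ e v = v) ∨ ∀ v, ρ e v = -v) :
    p = 5 ∧ HasFrame (q8Endos p) ρ := by
  have := hirr.nontrivial
  let σ : Representation (ZMod p) (G ⧸ MonoidHom.ker ρ) V :=
    QuotientGroup.lift (MonoidHom.ker ρ) ρ fun g hg => hg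
  have hσ : ∀ g : G, σ (QuotientGroup.mk g) = ρ g := fun g => rfl
  have hsurj := QuotientGroup.mk_surjective (s := MonoidHom.ker ρ)
  obtain ⟨h5, S, hS, ε, hbij, hε⟩ := unsplit_faithful (ρ := σ) hp (hG.to_quotient _) (by
      intro x y hxy
      obtain ⟨g, rfl⟩ := hsurj x
      obtain ⟨h, rfl⟩ := hsurj y
      rw [hσ, hσ] at hxy
      rw [QuotientGroup.eq, MonoidHom.mem_ker, map_mul, ← hxy, ← map_mul, inv_mul_cancel, map_one])
    (Representation.isIrreducible_of_submodule fun U hU => hirr.submodule_eq fun g => hU g)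
    (fun x k hk => by
      obtain ⟨g, rfl⟩ := hsurj x
      exact htr g k hk)
    (fun v c hc => by
      obtain ⟨g, hg⟩ := heig v c hc
      exact ⟨g, hg⟩)
    (fun x hx hx' => by
      obtain ⟨e, rfl⟩ := hsurj x
      exact hne e hx fun g => hx' g)
  exact ⟨h5, S, hS, ε, hbij, fun g => hε g⟩

/-- Irreducible representations over `F_p` of finite `2`-groups with the eigenvector property and
odd-power trace exist only for `p = 5`, where they have a `Q8`-frame. -/
theorem irreducible_classification (hp : 5 ≤ p) (n : ℕ) :
    ∀ (G V : Type*) [Group G] [Finite G] [AddCommGroup V] [Module (ZMod p) V]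
      [FiniteDimensional (ZMod p) V] (ρ : Representation (ZMod p) G V) (_ : IsPGroup 2 G)
      (_ : ρ.IsIrreducible) (_ : HasOddPowerTrace ρ) (_ : HasEigenvectorProperty ρ)
      (_ : finrank (ZMod p) V = n), p = 5 ∧ HasFrame (q8Endos p) ρ := by
  induction n using Nat.strong_induction_on with
  | _ n ih =>
  intro G V _ _ _ _ _ ρ hG hirr htr heig hn
  have h2 : (2 : ZMod p) ≠ 0 := ZMod.two_ne_zero_of_five_le hp
  by_cases hne : ∀ e : G, (∀ v, ρ e (ρ e v) = v) →
      (∀ g, (∀ v, ρ g (ρ e v) = ρ e (ρ g v)) ∨ ∀ v, ρ g (ρ e v) = -ρ e (ρ g v)) →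
      (∀ v, ρ e v = v) ∨ ∀ v, ρ e v = -v
  · exact unsplit_classification hp hG hirr htr heig hne
  push Not at hne
  obtain ⟨e, he2, hconj, ⟨v₁, hv₁⟩, v₂, hv₂⟩ := hne
  -- `e` is not central, since it is not a scalar
  obtain ⟨s, hs⟩ : ∃ s, s ∉ ρ.commutingSubgroup (ρ e) := by
    by_contra! hall
    rcases hirr.eq_smul_or_eq_smul (T := ρ e) (α := 1) (β := -1) (fun g v => (hall g v).symm)
      (fun v => by
        rw [map_sub, he2, map_smul]
        module) with h | h
    · exact hv₁ (by rw [h, one_smul])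
    · exact hv₂ (by rw [h, neg_one_smul])
  set N := ρ.commutingSubgroup (ρ e)
  have hindex : N.index = 2 := ρ.commutingSubgroup_index hconj hs
  have hW : ∀ g ∈ N, ∀ v ∈ End.eigenspace (ρ e) (1 : ZMod p), ρ g v ∈ End.eigenspace (ρ e) 1 :=
    Representation.eigenspace_stable
  obtain ⟨hbot, htop⟩ := Representation.eigenspace_ne (ρ := ρ) (T := ρ e) (α := 1) (s := s)
    (fun v => by rw [he2, mul_one, one_smul]) hs
  have hdim := hirr.finrank_eq_two_mul hindex hs hW hbot htop
  have hpos : 0 < finrank (ZMod p) (End.eigenspace (ρ e) (1 : ZMod p)) :=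
    Module.finrank_pos_iff.2 (Submodule.nontrivial_iff_ne_bot.2 hbot)
  obtain ⟨h5, hframe⟩ := ih (finrank (ZMod p) (End.eigenspace (ρ e) (1 : ZMod p))) (by omega) N _ _
    (hG.to_subgroup N)
    (hirr.stableSubrep hindex hs hW hbot htop) (htr.stableSubrep_eigenspace_one h2 he2)
    (heig.stableSubrep hW fun g hg v hv hgv => by
      rw [End.mem_eigenspace_iff, one_smul] at hv hgv
      have h1 := (hconj g).resolve_left hg v
      rw [hgv, hv] at h1
      have h3 : (2 : ZMod p) • ρ g v = 0 := by
        rw [two_smul]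
        nth_rewrite 2 [h1]
        exact add_neg_cancel _
      exact (ρ.apply_bijective g).1
        (((smul_eq_zero.1 h3).resolve_left h2).trans (map_zero _).symm)) rfl
  exact ⟨h5, hframe.induce hindex hs hW (hirr.isCompl_map hindex hs hW hbot htop)⟩

theorem IsRationalGroup.hasOddPowerTrace [Finite G] (hG : IsPGroup 2 G) (hrat : IsRationalGroup G)
    (ρ : Representation (ZMod p) G V) : HasOddPowerTrace ρ := by
  intro g k hk
  have hz : Subgroup.zpowers (g ^ k) = Subgroup.zpowers g := by
    refine le_antisymm (Subgroup.zpowers_le.2 (Subgroup.npow_mem_zpowers g k))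
      (Subgroup.zpowers_le.2 ?_)
    have := mem_zpowers_zpow_of_odd hG g (j := k) (by exact_mod_cast hk)
    rwa [zpow_natCast] at this
  obtain ⟨c, hc⟩ := isConj_iff.1 (hrat g (g ^ k) hz)
  rw [← hc, map_mul ρ, LinearMap.trace_mul_comm, ← map_mul ρ, inv_mul_cancel_left]

/-- Every representation over `F_p` with the eigenvector property of a rational finite `2`-group has
a `Q8`-frame, and `p = 5` unless the space is zero. -/
theorem rational_classification (hp : 5 ≤ p) [Finite G] (hG : IsPGroup 2 G)
    (hrat : IsRationalGroup G) (n : ℕ) :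
    ∀ (V : Type*) [AddCommGroup V] [Module (ZMod p) V]
      [FiniteDimensional (ZMod p) V] [Nontrivial V] (ρ : Representation (ZMod p) G V)
      (_ : HasEigenvectorProperty ρ)
      (_ : finrank (ZMod p) V = n), p = 5 ∧ HasFrame (q8Endos p) ρ := by
  induction n using Nat.strong_induction_on with
  | _ n ih =>
  intro V _ _ _ _ ρ heig hn
  by_cases hirr : ρ.IsIrreducible
  · exact irreducible_classification hp _ G V ρ hG hirr (hrat.hasOddPowerTrace hG ρ) heig rfl
  obtain ⟨W, hWbot, hWtop⟩ : ∃ W : Subrepresentation ρ, W ≠ ⊥ ∧ W ≠ ⊤ := by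
    by_contra! hall
    refine hirr (Representation.isIrreducible_of_submodule fun U hU => ?_)
    by_cases hb : U = ⊥
    · exact Or.inl hb
    · exact Or.inr (congrArg Subrepresentation.toSubmodule (hall ⟨U, fun g v hv => hU g v hv⟩
        fun h => hb (congrArg Subrepresentation.toSubmodule h)))
  have hcard : NeZero (Nat.card G : ZMod p) := by
    obtain ⟨k, hk⟩ := IsPGroup.iff_card.1 hG
    rw [hk]
    exact ⟨by
      push_cast
      exact pow_ne_zero k (ZMod.two_ne_zero_of_five_le hp)⟩
  obtain ⟨W', hWW'⟩ := exists_isCompl W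
  have hc : IsCompl W.toSubmodule W'.toSubmodule :=
    ⟨disjoint_iff.2 (congrArg Subrepresentation.toSubmodule hWW'.inf_eq_bot),
      codisjoint_iff.2 (congrArg Subrepresentation.toSubmodule hWW'.sup_eq_top)⟩
  have hsum := Submodule.finrank_add_eq_of_isCompl hc
  have hn1 : Nontrivial W.toSubmodule := Submodule.nontrivial_iff_ne_bot.2 fun h =>
    hWbot (Subrepresentation.toSubmodule_injective h)
  have hn2 : Nontrivial W'.toSubmodule := Submodule.nontrivial_iff_ne_bot.2 fun h =>
    hWtop (Subrepresentation.toSubmodule_injective (by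
      rw [h] at hc
      exact eq_top_of_isCompl_bot hc))
  have hp1 := Module.finrank_pos (R := ZMod p) (M := W.toSubmodule)
  have hp2 := Module.finrank_pos (R := ZMod p) (M := W'.toSubmodule)
  have heig' : ∀ W : Subrepresentation ρ, HasEigenvectorProperty W.toRepresentation := by
    intro W v c hc
    obtain ⟨g, hg⟩ := heig v c hc
    exact ⟨g, Subtype.ext hg⟩
  obtain ⟨h5, h₁⟩ := ih _ (by omega) W.toSubmodule W.toRepresentation (heig' W) rfl
  obtain ⟨-, h₂⟩ := ih _ (by omega) W'.toSubmodule W'.toRepresentation (heig' W') rfl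
  exact ⟨h5, HasFrame.of_isCompl hc h₁ h₂⟩

end UnsplitClassification

/-! ### The quaternion group acting on `F₅²` -/

section Quaternion

/-- The projection of `Q8` onto the Klein four-group, its quotient by the centre. -/
def q8Colour : Q8 → ZMod 2 × ZMod 2
  | QuaternionGroup.a i => (i.val, 0)
  | QuaternionGroup.xa i => (i.val, 1)

/-- For each nonzero colour `t`, two vectors of `F₅²` spanning the two eigenlines of the elements of
`Q8` of colour `t`; the value at the colour zero is irrelevant. -/
def colourVector (t : ZMod 2 × ZMod 2) (σ : Bool) : Fin 2 → ZMod 5 :=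
  if t = (1, 0) then (if σ then ![0, 1] else ![1, 0])
  else if t = (0, 1) then (if σ then ![1, 3] else ![1, 2])
  else (if σ then ![1, 1] else ![1, 4])

/-- The element of `Q8` of colour `t` which doubles `colourVector t σ`. -/
def colourElement (t : ZMod 2 × ZMod 2) (σ : Bool) : Q8 :=
  if t = (1, 0) then (if σ then QuaternionGroup.a 3 else QuaternionGroup.a 1)
  else if t = (0, 1) then (if σ then QuaternionGroup.xa 2 else QuaternionGroup.xa 0)
  else (if σ then QuaternionGroup.xa 3 else QuaternionGroup.xa 1)

theorem q8Rep_apply (q : Q8) (u : Fin 2 → ZMod 5) : q8Rep q u = (q8Matrix q).mulVec u := rfl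

theorem q8Colour_mul : ∀ q r : Q8, q8Colour (q * r) = q8Colour q + q8Colour r := by decide

theorem q8Colour_one : q8Colour 1 = 0 := by decide

theorem q8Colour_inv : ∀ q : Q8, q8Colour q⁻¹ = -q8Colour q := by decide

theorem eq_of_q8Colour_eq_zero : ∀ q : Q8, q8Colour q = 0 → q ≠ 1 → q = QuaternionGroup.a 2 := by
  decide

theorem q8Colour_colourElement : ∀ t σ, t ≠ 0 → q8Colour (colourElement t σ) = t := by decide

theorem colourElement_mul_inv : ∀ t σ, colourElement t σ * (colourElement t false)⁻¹ =
    if σ then QuaternionGroup.a 2 else 1 := by decide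

set_option maxRecDepth 10000 in
/-- If an element of `Q8` maps a vector of colour `t` to the double of a vector of colour `t'`, then
the two colours agree. -/
theorem eq_of_q8Matrix_mulVec_colourVector : ∀ (q : Q8) (t t' : ZMod 2 × ZMod 2), t ≠ 0 → t' ≠ 0 →
    ∀ σ σ' : Bool, (q8Matrix q).mulVec (colourVector t σ) = 2 • colourVector t' σ' → t' = t := by
  decide

set_option maxRecDepth 10000 in
theorem eq_colourElement : ∀ (q : Q8) (t : ZMod 2 × ZMod 2), t ≠ 0 → ∀ σ : Bool,
    (q8Matrix q).mulVec (colourVector t σ) = 2 • colourVector t σ → q = colourElement t σ := by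
  decide

theorem q8Rep_injective : Function.Injective q8Rep := by
  have h : ∀ q : Q8, (q8Matrix q).mulVec ![1, 0] = ![1, 0] → q = 1 := by decide
  rw [injective_iff_map_eq_one]
  intro q hq
  refine h q ?_
  rw [← q8Rep_apply, hq]
  rfl

end Quaternion

/-! ### Groups with a `Q8`-frame as wreath products -/

section Wreath

open Module

variable [Fact (Nat.Prime 5)] {G V : Type*} [Group G] [AddCommGroup V] [Module (ZMod 5) V]
  {ρ : Representation (ZMod 5) G V} {n : ℕ}

/-- The maps `ε i` of a frame with index set `Fin n`, the permutation action of the group on the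
indices, and the coordinates `q g i` in `Q8`, which form a cocycle. -/
structure Q8Frame (ρ : Representation (ZMod 5) G V) (n : ℕ) [MulAction G (Fin n)] where
  /-- the embeddings of the copies of `F₅²` -/
  ε : Fin n → (Fin 2 → ZMod 5) →ₗ[ZMod 5] V
  /-- the coordinates of the group elements in `Q8` -/
  q : G → Fin n → Q8
  bijective_sum : Function.Bijective fun u : Fin n → Fin 2 → ZMod 5 => ∑ i, ε i (u i)
  apply_ε : ∀ g i u, ρ g (ε i u) = ε (g • i) (q8Rep (q g i) u)
  q_mul : ∀ g h i, q (g * h) i = q g (h • i) * q h i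

theorem HasFrame.exists_q8Frame (h : HasFrame (q8Endos 5) ρ) :
    ∃ (n : ℕ) (_ : MulAction G (Fin n)), Nonempty (Q8Frame ρ n) := by
  obtain ⟨S, _, ε, hbij, hε⟩ := h
  let e := (Fintype.equivFin S).symm
  have hbij' : Function.Bijective fun u : Fin (Fintype.card S) → Fin 2 → ZMod 5 =>
      ∑ i, ε (e i) (u i) := by
    convert hbij.comp (Equiv.arrowCongr e (Equiv.refl (Fin 2 → ZMod 5))).bijective using 1
    funext u
    simpa using Equiv.sum_comp e fun i => ε i (u (e.symm i))
  have hsingle : ∀ i u, ∑ j, ε (e j) ((Pi.single i u : Fin (Fintype.card S) → Fin 2 → ZMod 5) j) =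
      ε (e i) u := by
    intro i u
    rw [Finset.sum_eq_single i (fun j _ hj => by rw [Pi.single_eq_of_ne hj, map_zero])
      (fun hi => absurd (Finset.mem_univ i) hi), Pi.single_eq_same]
  have huniq : ∀ i u j w, u ≠ 0 → ε (e i) u = ε (e j) w → i = j ∧ u = w := by
    intro i u j w hu h
    rw [← hsingle i u, ← hsingle j w] at h
    have h1 := congrFun (hbij'.1 h) i
    rw [Pi.single_eq_same] at h1
    by_cases hij : i = j
    · subst hij
      exact ⟨rfl, by rw [h1, Pi.single_eq_same]⟩
    · rw [Pi.single_eq_of_ne hij] at h1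
      exact absurd h1 hu
  have hact : ∀ g i, ∃ j, ∃ r : Q8, ∀ u, ρ g (ε (e i) u) = ε (e j) (q8Rep r u) := by
    intro g i
    obtain ⟨j, T, hT, hj⟩ := hε g (e i)
    obtain ⟨r, rfl⟩ := mem_q8Endos.1 hT
    exact ⟨e.symm j, r, fun u => by rw [hj, Equiv.apply_symm_apply]⟩
  choose π q hq using hact
  have hq0 : ∀ r u, u ≠ 0 → q8Rep r u ≠ 0 := fun r u hu h =>
    hu ((q8Rep.apply_bijective r).1 (h.trans (map_zero _).symm))
  obtain ⟨u₀, hu₀⟩ := exists_ne (0 : Fin 2 → ZMod 5)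
  have heq : ∀ i j r r', (∀ u, ε (e i) (q8Rep r u) = ε (e j) (q8Rep r' u)) → i = j ∧ r = r' := by
    intro i j r r' h
    refine ⟨(huniq _ _ _ _ (hq0 r u₀ hu₀) (h u₀)).1, q8Rep_injective (LinearMap.ext fun u => ?_)⟩
    by_cases hu : u = 0
    · rw [hu, map_zero, map_zero]
    · exact (huniq _ _ _ _ (hq0 r u hu) (h u)).2
  have hone : ∀ i, π 1 i = i := fun i => (heq _ _ (q 1 i) 1 fun u => by
    rw [← hq, map_one, map_one, Module.End.one_apply, Module.End.one_apply]).1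
  have hmul : ∀ g h i, π (g * h) i = π g (π h i) ∧ q (g * h) i = q g (π h i) * q h i :=
    fun g h i => heq _ _ _ _ fun u => by
      rw [← hq, ← ρ.apply_mul_apply, hq, hq, q8Rep.apply_mul_apply]
  let _ : MulAction G (Fin (Fintype.card S)) :=
    { smul := π, one_smul := hone, mul_smul := fun g h i => (hmul g h i).1 }
  exact ⟨Fintype.card S, inferInstance,
    ⟨{ ε := fun i => ε (e i), q := q, bijective_sum := hbij', apply_ε := hq,
       q_mul := fun g h i => (hmul g h i).2 }⟩⟩

namespace Q8Frame

variable [MulAction G (Fin n)] (F : Q8Frame ρ n)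

/-- The coordinates of a vector with respect to a frame. -/
noncomputable def coord : (Fin n → Fin 2 → ZMod 5) ≃ₗ[ZMod 5] V :=
  LinearEquiv.ofBijective (∑ i, F.ε i ∘ₗ LinearMap.proj i) (by
    convert F.bijective_sum using 1
    funext u
    simp)

theorem coord_apply (u : Fin n → Fin 2 → ZMod 5) : F.coord u = ∑ i, F.ε i (u i) := by
  simp [coord]

theorem apply_coord (g : G) (u : Fin n → Fin 2 → ZMod 5) :
    ρ g (F.coord u) = F.coord fun i => q8Rep (F.q g (g⁻¹ • i)) (u (g⁻¹ • i)) := by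
  rw [coord_apply, coord_apply, map_sum,
    ← Equiv.sum_comp (MulAction.toPerm g : Equiv.Perm (Fin n))
      fun i => F.ε i (q8Rep (F.q g (g⁻¹ • i)) (u (g⁻¹ • i)))]
  refine Finset.sum_congr rfl fun i _ => ?_
  rw [F.apply_ε, MulAction.toPerm_apply, inv_smul_smul]

theorem q_one (i : Fin n) : F.q 1 i = 1 := by
  have h := F.q_mul 1 1 i
  rw [mul_one, one_smul] at h
  exact mul_eq_left.1 h.symm

/-- The elements of `Q8 ^ n` through which elements of the group fixing all indices act. -/
def base : Subgroup (Fin n → Q8) where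
  carrier := {f | ∃ g : G, (∀ i : Fin n, g • i = i) ∧ F.q g = f}
  one_mem' := ⟨1, fun i => one_smul G i, funext F.q_one⟩
  mul_mem' := by
    rintro _ _ ⟨g, hg, rfl⟩ ⟨h, hh, rfl⟩
    exact ⟨g * h, fun i => by rw [mul_smul, hh, hg], funext fun i => by
      rw [F.q_mul, hh, Pi.mul_apply]⟩
  inv_mem' := by
    rintro _ ⟨g, hg, rfl⟩
    have hg' : ∀ i : Fin n, g⁻¹ • i = i := fun i => by rw [inv_smul_eq_iff, hg]
    refine ⟨g⁻¹, hg', funext fun i => ?_⟩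
    have h := F.q_mul g⁻¹ g i
    rw [inv_mul_cancel, F.q_one, hg] at h
    exact eq_inv_of_mul_eq_one_left h.symm

/-- A group element doubling a vector with all coordinates of the form `colourVector` preserves the
colours; if the colouring has trivial stabiliser, it acts through the corresponding elements of
`Q8`. -/
theorem colourElement_mem_base (heig : HasEigenvectorProperty ρ) {t : Fin n → ZMod 2 × ZMod 2}
    (ht : ∀ i, t i ≠ 0) (hst : ∀ g : G, (∀ i, t (g • i) = t i) → ∀ i : Fin n, g • i = i)
    (σ : Fin n → Bool) : (fun i => colourElement (t i) (σ i)) ∈ F.base := by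
  have h2 : (2 : ZMod 5) ≠ 0 := ZMod.two_ne_zero_of_five_le le_rfl
  obtain ⟨g, hg⟩ := heig (F.coord fun i => colourVector (t i) (σ i)) 2 h2
  rw [F.apply_coord, ← map_smul] at hg
  have hg' : ∀ i, (q8Matrix (F.q g i)).mulVec (colourVector (t i) (σ i)) =
      2 • colourVector (t (g • i)) (σ (g • i)) := by
    intro i
    have h := congrFun (F.coord.injective hg) (g • i)
    rw [inv_smul_smul, q8Rep_apply] at h
    rw [h, Pi.smul_apply, two_smul, two_smul]
  have hfix := hst g fun i => eq_of_q8Matrix_mulVec_colourVector _ _ _ (ht i) (ht _) _ _ (hg' i)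
  refine ⟨g, hfix, funext fun i => eq_colourElement _ _ (ht i) _ ?_⟩
  have h := hg' i
  rwa [hfix] at h

/-- A `2`-group with the eigenvector property contains the full base group `Q8 ^ n`: it contains all
sign changes, and modulo those it contains all colourings with trivial stabiliser. -/
theorem base_eq_top [Finite G] (hG : IsPGroup 2 G) (heig : HasEigenvectorProperty ρ) :
    F.base = ⊤ := by
  obtain ⟨⟨t₀, ht₀, hst₀⟩, hD⟩ := exists_colouring_and_closure_eq_top (S := Fin n) hG
  have hsign : ∀ σ : Fin n → Bool,
      (fun i => if σ i then QuaternionGroup.a 2 else 1) ∈ F.base := by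
    intro σ
    convert F.base.mul_mem (F.colourElement_mem_base heig ht₀ hst₀ σ)
      (F.base.inv_mem (F.colourElement_mem_base heig ht₀ hst₀ fun _ => false)) using 1
    funext i
    exact (colourElement_mul_inv (t₀ i) (σ i)).symm
  let D : AddSubgroup (Fin n → ZMod 2 × ZMod 2) :=
    { carrier := {w | ∃ f ∈ F.base, ∀ i, q8Colour (f i) = w i}
      zero_mem' := ⟨1, F.base.one_mem, fun _ => q8Colour_one⟩
      add_mem' := by
        rintro w w' ⟨f, hf, hw⟩ ⟨f', hf', hw'⟩
        exact ⟨f * f', F.base.mul_mem hf hf', fun i => by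
          rw [Pi.mul_apply, q8Colour_mul, hw, hw', Pi.add_apply]⟩
      neg_mem' := by
        rintro w ⟨f, hf, hw⟩
        exact ⟨f⁻¹, F.base.inv_mem hf, fun i => by
          rw [Pi.inv_apply, q8Colour_inv, hw, Pi.neg_apply]⟩ }
  have hDtop : D = ⊤ := hD D fun t ht hst =>
    ⟨_, F.colourElement_mem_base heig ht hst fun _ => false, fun i =>
      q8Colour_colourElement _ _ (ht i)⟩
  rw [Subgroup.eq_top_iff']
  intro f
  obtain ⟨r, hr, hrf⟩ : (fun i => q8Colour (f i)) ∈ D := hDtop ▸ AddSubgroup.mem_top _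
  have h : r⁻¹ * f ∈ F.base := by
    convert hsign fun i => !decide ((r⁻¹ * f) i = 1) using 1
    funext i
    have h0 := eq_of_q8Colour_eq_zero ((r⁻¹ * f) i) (by
      rw [Pi.mul_apply, Pi.inv_apply, q8Colour_mul, q8Colour_inv, hrf, neg_add_cancel])
    by_cases h1 : (r⁻¹ * f) i = 1
    · rw [h1, decide_eq_true rfl]
      rfl
    · rw [decide_eq_false h1]
      exact h0 h1
  simpa using F.base.mul_mem hr h

/-- The permutation group induced on the indices of a frame. -/
abbrev permGroup (_ : Q8Frame ρ n) : Subgroup (Equiv.Perm (Fin n)) :=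
  (MulAction.toPermHom G (Fin n)).range

/-- The homomorphism to the wreath product given by a frame. -/
def toWreath : G →* PermWreath Q8 F.permGroup where
  toFun g := ⟨fun i => F.q g (g⁻¹ • i), ⟨MulAction.toPermHom G (Fin n) g, g, rfl⟩⟩
  map_one' := by
    refine SemidirectProduct.ext (funext fun i => F.q_one _) (Subtype.ext (map_one _))
  map_mul' g h := by
    refine SemidirectProduct.ext (funext fun i => ?_) (Subtype.ext (map_mul _ _ _))
    change F.q (g * h) ((g * h)⁻¹ • i) = F.q g (g⁻¹ • i) * F.q h (h⁻¹ • g⁻¹ • i)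
    rw [F.q_mul, mul_inv_rev, mul_smul, smul_inv_smul]

theorem toWreath_injective (hρ : Function.Injective ρ) : Function.Injective F.toWreath := by
  rw [injective_iff_map_eq_one]
  intro g hg
  have h1 : ∀ i : Fin n, g • i = i := fun i =>
    congrArg (fun x : PermWreath Q8 F.permGroup => (x.right : Equiv.Perm (Fin n)) i) hg
  have h2 : ∀ i, F.q g (g⁻¹ • i) = 1 := fun i =>
    congrArg (fun x : PermWreath Q8 F.permGroup => x.left i) hg
  refine hρ (LinearMap.ext fun v => ?_)
  obtain ⟨u, rfl⟩ := F.coord.surjective v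
  rw [F.apply_coord, map_one, Module.End.one_apply]
  congr 1
  funext i
  rw [h2, map_one, Module.End.one_apply, inv_smul_eq_iff.2 (h1 i).symm]

theorem toWreath_surjective (hbase : F.base = ⊤) : Function.Surjective F.toWreath := by
  rintro ⟨f, ⟨_, g₀, rfl⟩⟩
  obtain ⟨g₁, hg₁, hq⟩ : (fun i => f i * (F.q g₀ (g₀⁻¹ • i))⁻¹) ∈ F.base :=
    hbase ▸ Subgroup.mem_top _
  have hg₁' : ∀ i : Fin n, g₁⁻¹ • i = i := fun i => inv_smul_eq_iff.2 (hg₁ i).symm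
  refine ⟨g₁ * g₀, SemidirectProduct.ext (funext fun i => ?_) (Subtype.ext (Equiv.ext fun i => ?_))⟩
  · change F.q (g₁ * g₀) ((g₁ * g₀)⁻¹ • i) = f i
    rw [F.q_mul, mul_inv_rev, mul_smul, hg₁', smul_inv_smul, hq, inv_mul_cancel_right]
  · change (g₁ * g₀) • i = g₀ • i
    rw [mul_smul, hg₁]

/-- The homomorphism from the semidirect product to the wreath product given by a frame: a vector
and a group element are sent to their coordinates. -/
noncomputable def semidirectToWreath : RepSemidirect ρ →* PermWreath FrobeniusM F.permGroup where
  toFun x := ⟨fun i => ⟨Multiplicative.ofAdd (F.coord.symm x.left.toAdd i),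
    (F.toWreath x.right).left i⟩, (F.toWreath x.right).right⟩
  map_one' := by
    refine SemidirectProduct.ext (funext fun i => SemidirectProduct.ext ?_ ?_) ?_
    · change Multiplicative.ofAdd (F.coord.symm 0 i) = 1
      rw [map_zero]
      rfl
    · rw [SemidirectProduct.one_right, map_one]
      rfl
    · rw [SemidirectProduct.one_right, map_one]
      rfl
  map_mul' x y := by
    refine SemidirectProduct.ext (funext fun i => SemidirectProduct.ext ?_ ?_) ?_
    · change Multiplicative.ofAdd (F.coord.symm (x.left.toAdd + ρ x.right y.left.toAdd) i) =
        Multiplicative.ofAdd (F.coord.symm x.left.toAdd i +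
          q8Rep (F.q x.right (x.right⁻¹ • i)) (F.coord.symm y.left.toAdd (x.right⁻¹ • i)))
      obtain ⟨u, hu⟩ := F.coord.surjective y.left.toAdd
      rw [← hu, F.apply_coord, map_add, LinearEquiv.symm_apply_apply, LinearEquiv.symm_apply_apply,
        Pi.add_apply]
    · rw [SemidirectProduct.mul_right, map_mul]
      rfl
    · rw [SemidirectProduct.mul_right, map_mul]
      rfl

theorem semidirectToWreath_bijective (h : Function.Bijective F.toWreath) :
    Function.Bijective F.semidirectToWreath := by
  constructor
  · intro x y hxy
    have h1 : F.toWreath x.right = F.toWreath y.right := SemidirectProduct.ext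
      (funext fun i => congrArg
        (fun z : PermWreath FrobeniusM F.permGroup => (z.left i).right) hxy)
      (congrArg (fun z : PermWreath FrobeniusM F.permGroup => z.right) hxy)
    have h2 : F.coord.symm x.left.toAdd = F.coord.symm y.left.toAdd := funext fun i =>
      congrArg (fun z : PermWreath FrobeniusM F.permGroup => (z.left i).left.toAdd) hxy
    exact SemidirectProduct.ext (F.coord.symm.injective h2) (h.1 h1)
  · rintro ⟨f, κ⟩
    obtain ⟨g, hg⟩ := h.2 ⟨fun i => (f i).right, κ⟩
    refine ⟨⟨Multiplicative.ofAdd (F.coord fun i => (f i).left.toAdd), g⟩,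
      SemidirectProduct.ext (funext fun i => SemidirectProduct.ext ?_ ?_) ?_⟩
    · change Multiplicative.ofAdd (F.coord.symm (F.coord fun i => (f i).left.toAdd) i) = (f i).left
      rw [LinearEquiv.symm_apply_apply]
      rfl
    · exact congrArg (fun z : PermWreath Q8 F.permGroup => z.left i) hg
    · exact congrArg (fun z : PermWreath Q8 F.permGroup => z.right) hg

theorem finrank_eq (F : Q8Frame ρ n) : finrank (ZMod 5) V = 2 * n := by
  rw [← F.coord.finrank_eq, Module.finrank_pi_fintype]
  simp [mul_comm]

end Q8Frame

end Wreath

theorem theoremA (p : ℕ) [Fact p.Prime] (hp : 5 ≤ p)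
    (G : Type*) [Group G] [Finite G] (hG2 : IsPGroup 2 G) (hGrat : IsRationalGroup G)
    (V : Type*) [AddCommGroup V] [Module (ZMod p) V] [FiniteDimensional (ZMod p) V] [Nontrivial V]
    (ρ : Representation (ZMod p) G V) (hfaithful : Function.Injective ρ)
    (heig : HasEigenvectorProperty ρ) :
    p = 5 ∧ ∃ (n : ℕ) (K : Subgroup (Equiv.Perm (Fin n))),
      IsPGroup 2 K ∧ Nonempty (G ≃* PermWreath Q8 K) ∧
        Module.finrank (ZMod p) V = 2 * n ∧ Nonempty (RepSemidirect ρ ≃* PermWreath FrobeniusM K) := by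
  obtain ⟨h5, hframe⟩ := rational_classification hp hG2 hGrat _ V ρ heig rfl
  refine ⟨h5, ?_⟩
  subst h5
  obtain ⟨n, _, ⟨F⟩⟩ := hframe.exists_q8Frame
  have hbij : Function.Bijective F.toWreath :=
    ⟨F.toWreath_injective hfaithful, F.toWreath_surjective (F.base_eq_top hG2 heig)⟩
  exact ⟨n, F.permGroup,
    hG2.of_surjective _ (MulAction.toPermHom G (Fin n)).rangeRestrict_surjective,
    ⟨MulEquiv.ofBijective F.toWreath hbij⟩, F.finrank_eq,
    ⟨MulEquiv.ofBijective F.semidirectToWreath (F.semidirectToWreath_bijective hbij)⟩⟩
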